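/- **Closed-form outage probabilities and accuracy indices for a Poisson field of interferers with Rayleigh fading.** *Model.* Let $p,c,\alpha,a,\lambda,\beta>0$, $\sigma\ge 0$, $d_0\ge a$, $r_{\mathrm{IBM}}\ge a$, $r_{\mathrm{PRM}}\ge a$. A receiver sits at the origin of the plane, its intended transmitter is at distance $d_0$, and the interferers are the points $X_k$ of a homogeneous Poisson point process on $\mathbb R^2$ with intensity $\lambda$; put $d_k=\|X_k\|$. The fading gains $h_0$ (intended link) and $h_k$ (interferers) are i.i.d. with density $e^{-x}$, $x>0$, and are independent of the point process. The channel gain of transmitter $i$ is $g_i=c\,h_i\,\ell(d_i)$, where $\ell(d)=d^{-\alpha}$ for $d\ge a$ and $\ell(d)=1$ for $d<a$. Define, with values in $[0,\infty]$, $$\gamma^{\mathrm{PhyM}}=\frac{p g_0}{\sum_k p g_k+\sigma},\qquad \gamma^{\mathrm{IBM}}=\frac{p g_0}{\sum_{k:\,d_k\le r_{\mathrm{IBM}}} p g_k+\sigma},$$ and let $\gamma^{\mathrm{PRM}}=0$ if some $d_k\le r_{\mathrm{PRM}}$ and $\gamma^{\mathrm{PRM}}=\infty$ otherwise (equivalently,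 almost surely, $\gamma^{\mathrm{PRM}}=p g_0/\sum_k p\,a_kg_k$ with $a_k=\infty$ if $d_k\le r_{\mathrm{PRM}}$ and $a_k=0$ otherwise); thus outage $\gamma^{\mathrm{PRM}}<\beta$ under the protocol model means that some interferer is within distance $r_{\mathrm{PRM}}$. For models $\mathrm x,\mathrm y$ put $p_{\mathrm{fa}}^{\mathrm x|\mathrm y}=\Pr[\gamma^{\mathrm x}<\beta\mid\gamma^{\mathrm y}\ge\beta]$, $p_{\mathrm{md}}^{\mathrm x|\mathrm y}=\Pr[\gamma^{\mathrm x}\ge\beta\mid\gamma^{\mathrm y}<\beta]$ and, for $\xi\in[0,1]$, $S_{\beta,\xi}(\mathrm x\|\mathrm y)=\xi(1-p_{\mathrm{fa}}^{\mathrm x|\mathrm y})+(1-\xi)(1-p_{\mathrm{md}}^{\mathrm x|\mathrm y})$. Let $\Gamma(s,x)=\int_x^\infty t^{s-1}e^{-t}\,dt$, let $\mathbf E_h$ be expectation over $h$ with density $e^{-x}$, $x>0$, and abbreviate $s_h=\beta d_0^\alpha h$. *Claim.* (The variables under each $\mathbf E_h$ below are integrable.) 1. $\Pr[\gamma^{\mathrm{IBM}}<\beta]=P_{\mathrm{IBM}}$,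 where $$P_{\mathrm{IBM}}=1-\exp\Big\{-\tfrac{\sigma\beta d_0^\alpha}{pc}-\pi\lambda\,\mathbf E_h\Big[a^2(1-e^{-s_h})+r_{\mathrm{IBM}}^2(1-e^{-s_hr_{\mathrm{IBM}}^{-\alpha}})-a^2(1-e^{-s_ha^{-\alpha}})+s_h^{2/\alpha}\Gamma(1-\tfrac2\alpha,s_hr_{\mathrm{IBM}}^{-\alpha})-s_h^{2/\alpha}\Gamma(1-\tfrac2\alpha,s_ha^{-\alpha})\Big]\Big\}.$$ 2. $\Pr[\gamma^{\mathrm{PRM}}<\beta]=P_{\mathrm{PRM}}$, where $P_{\mathrm{PRM}}=1-e^{-\lambda\pi r_{\mathrm{PRM}}^2}$. If moreover $\alpha>2$, then: 3. $\Pr[\gamma^{\mathrm{PhyM}}<\beta]=P_{\mathrm{PhyM}}\in(0,1)$, where $$P_{\mathrm{PhyM}}=1-\exp\Big\{-\tfrac{\sigma\beta d_0^\alpha}{pc}-\pi\lambda\,\mathbf E_h\Big[a^2(1-e^{-s_h})-a^2(1-e^{-s_ha^{-\alpha}})+s_h^{2/\alpha}\Gamma(1-\tfrac2\alpha)-s_h^{2/\alpha}\Gamma(1-\tfrac2\alpha,s_ha^{-\alpha})\Big]\Big\}.$$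 4. $\Pr[\gamma^{\mathrm{PhyM}}<\beta\mid\gamma^{\mathrm{PRM}}\ge\beta]=Q$, where $$Q=1-\exp\Big\{-\tfrac{\sigma\beta d_0^\alpha}{pc}-\pi\lambda\,\mathbf E_h\Big[-r_{\mathrm{PRM}}^2(1-e^{-s_hr_{\mathrm{PRM}}^{-\alpha}})+s_h^{2/\alpha}\Gamma(1-\tfrac2\alpha)-s_h^{2/\alpha}\Gamma(1-\tfrac2\alpha,s_hr_{\mathrm{PRM}}^{-\alpha})\Big]\Big\}.$$ 5. $p_{\mathrm{fa}}^{\mathrm{IBM}|\mathrm{PhyM}}=0$ and $p_{\mathrm{md}}^{\mathrm{IBM}|\mathrm{PhyM}}=1-P_{\mathrm{IBM}}/P_{\mathrm{PhyM}}$. Hence $S_{\beta,\xi}(\mathrm{IBM}\|\mathrm{PhyM})=1-(1-\xi)(1-P_{\mathrm{IBM}}/P_{\mathrm{PhyM}})$ for every $\xi\in[0,1]$, and for $\xi=\Pr[\gamma^{\mathrm{PhyM}}\ge\beta]$ this equals $1-(P_{\mathrm{PhyM}}-P_{\mathrm{IBM}})$. 6. $p_{\mathrm{fa}}^{\mathrm{PRM}|\mathrm{PhyM}}=1-\frac{(1-P_{\mathrm{PRM}})(1-Q)}{1-P_{\mathrm{PhyM}}}$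 and $p_{\mathrm{md}}^{\mathrm{PRM}|\mathrm{PhyM}}=\frac{(1-P_{\mathrm{PRM}})Q}{P_{\mathrm{PhyM}}}$. Hence $S_{\beta,\xi}(\mathrm{PRM}\|\mathrm{PhyM})=1-\xi\,p_{\mathrm{fa}}^{\mathrm{PRM}|\mathrm{PhyM}}-(1-\xi)\,p_{\mathrm{md}}^{\mathrm{PRM}|\mathrm{PhyM}}$ with these values for every $\xi\in[0,1]$, and for $\xi=\Pr[\gamma^{\mathrm{PhyM}}\ge\beta]$ this equals $P_{\mathrm{PhyM}}+(1-P_{\mathrm{PRM}})(1-2Q)$. -/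

import Mathlib

open MeasureTheory ProbabilityTheory Set
open scoped ENNReal NNReal

noncomputable section

namespace OutageModel

/-- The plane with its Euclidean norm and Lebesgue measure; the typical receiver sits at `0`. -/
abbrev Plane : Type := EuclideanSpace ℝ (Fin 2)

/-- Number of points of the configuration `x` that lie in `B`, counted with multiplicity. -/
def pointCount {E : Type*} (x : ℕ → E) (B : Set E) : ℕ∞ :=
  Set.encard {k : ℕ | x k ∈ B}

/-- The (measurably enumerated) random points `X 0, X 1, …` form a Poisson point process with
intensity measure `Λ`: Poisson counts on sets of finite intensity, independent counts on
disjoint sets. -/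
structure IsPoissonProcess {Ω E : Type*} [MeasurableSpace Ω] [MeasurableSpace E]
    (P : Measure Ω) (X : ℕ → Ω → E) (Λ : Measure E) : Prop where
  measurable : ∀ k, Measurable (X k)
  count_law : ∀ B : Set E, MeasurableSet B → Λ B ≠ ∞ → ∀ n : ℕ,
    P {ω | pointCount (fun k => X k ω) B = (n : ℕ∞)} = poissonMeasure (Λ B).toNNReal {n}
  count_indep : ∀ (m : ℕ) (B : Fin m → Set E), (∀ i, MeasurableSet (B i)) →
    Pairwise (Function.onFun Disjoint B) →
    iIndepFun (fun (i : Fin m) (ω : Ω) => pointCount (fun k => X k ω) (B i)) P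

/-- Homogeneous planar Poisson field of interferers of intensity `lam`, at positions `X k`, with
Rayleigh fading: the power gains `h₀` (intended link) and `h k` (interferer `k`) are i.i.d. with
density `exp (-x)` on `x > 0`, and are independent of the positions. -/
structure IsRayleighPoissonNetwork {Ω : Type*} [MeasurableSpace Ω] (P : Measure Ω)
    (lam : ℝ) (X : ℕ → Ω → Plane) (h₀ : Ω → ℝ) (h : ℕ → Ω → ℝ) : Prop where
  poisson : IsPoissonProcess P X (ENNReal.ofReal lam • (volume : Measure Plane))
  measurable_h₀ : Measurable h₀
  measurable_h : ∀ k, Measurable (h k)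
  law_h₀ : P.map h₀ = expMeasure 1
  law_h : ∀ k, P.map (h k) = expMeasure 1
  indep_h : iIndepFun h P
  indep_X_h : IndepFun (fun (ω : Ω) (k : ℕ) => X k ω) (fun (ω : Ω) (k : ℕ) => h k ω) P
  indep_h₀ : IndepFun h₀ (fun ω : Ω => ((fun k : ℕ => X k ω), (fun k : ℕ => h k ω))) P

/-- Deterministic parameters: transmission power `p`, attenuation `c` at unit distance, path-loss
exponent `α`, radius `a` of the disk without path loss, noise power `σ`, length `d₀` of the
intended link. -/
structure Params where
  (p c α a σ d₀ : ℝ)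

/-- Modified power law: `d ^ (-α)` outside the open disk of radius `a`, no attenuation inside. -/
def pathLoss (α a d : ℝ) : ℝ := if a ≤ d then d ^ (-α) else 1

/-- Channel gain `c h d ^ (-α 1_{d ≥ a})`. -/
def channelGain (q : Params) (h d : ℝ) : ℝ := q.c * h * pathLoss q.α q.a d

/-- SINR at the typical receiver when the channel gain of interferer `k` is multiplied by the
weight `w k ∈ [0, ∞]` and the noise power is `noise`. Values are in `[0, ∞]`. -/
def sinr (q : Params) (noise : ℝ) (w : ℕ → ℝ≥0∞) (x : ℕ → Plane) (h₀ : ℝ) (h : ℕ → ℝ) : ℝ≥0∞ :=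
  ENNReal.ofReal (q.p * channelGain q h₀ q.d₀) /
    ((∑' k, ENNReal.ofReal q.p * (w k * ENNReal.ofReal (channelGain q (h k) ‖x k‖)))
      + ENNReal.ofReal noise)

/-- Physical model: every interferer counts. -/
def sinrPhyM {Ω : Type*} (q : Params) (X : ℕ → Ω → Plane) (h₀ : Ω → ℝ) (h : ℕ → Ω → ℝ)
    (ω : Ω) : ℝ≥0∞ :=
  sinr q q.σ (fun _ => 1) (fun k => X k ω) (h₀ ω) (fun k => h k ω)

/-- Interference ball model: only interferers at distance at most `r` count. -/
def sinrIBM {Ω : Type*} (q : Params) (r : ℝ) (X : ℕ → Ω → Plane) (h₀ : Ω → ℝ) (h : ℕ → Ω → ℝ)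
    (ω : Ω) : ℝ≥0∞ :=
  sinr q q.σ (fun k => if ‖X k ω‖ ≤ r then 1 else 0) (fun k => X k ω) (h₀ ω) (fun k => h k ω)

/-- Protocol model: interferers at distance at most `r` have infinite virtual gain, all others
gain zero. Outage in this model is decided by the presence of an interferer in range alone, so
noise does not enter: the value is (almost surely) `0` if some interferer is within distance `r`
and `∞` otherwise. -/
def sinrPRM {Ω : Type*} (q : Params) (r : ℝ) (X : ℕ → Ω → Plane) (h₀ : Ω → ℝ) (h : ℕ → Ω → ℝ)
    (ω : Ω) : ℝ≥0∞ :=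
  sinr q 0 (fun k => if ‖X k ω‖ ≤ r then ∞ else 0) (fun k => X k ω) (h₀ ω) (fun k => h k ω)

/-- The event `γ < β`. -/
def outage {Ω : Type*} (γ : Ω → ℝ≥0∞) (β : ℝ) : Set Ω := {ω | γ ω < ENNReal.ofReal β}

/-- The event `γ ≥ β`. -/
def noOutage {Ω : Type*} (γ : Ω → ℝ≥0∞) (β : ℝ) : Set Ω := {ω | ENNReal.ofReal β ≤ γ ω}

/-- False alarm probability `Pr[γx < β | γy ≥ β]` of test model `γx` for reference `γy`. -/
def falseAlarm {Ω : Type*} [MeasurableSpace Ω] (P : Measure Ω) (β : ℝ) (γx γy : Ω → ℝ≥0∞) : ℝ :=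
  (cond P (noOutage γy β)).real (outage γx β)

/-- Miss-detection probability `Pr[γx ≥ β | γy < β]`. -/
def missDetection {Ω : Type*} [MeasurableSpace Ω] (P : Measure Ω) (β : ℝ)
    (γx γy : Ω → ℝ≥0∞) : ℝ :=
  (cond P (outage γy β)).real (noOutage γx β)

/-- Similarity (accuracy) index `S_{β,ξ}(γx ‖ γy)`. -/
def similarityIndex {Ω : Type*} [MeasurableSpace Ω] (P : Measure Ω) (β ξ : ℝ)
    (γx γy : Ω → ℝ≥0∞) : ℝ :=
  ξ * (1 - falseAlarm P β γx γy) + (1 - ξ) * (1 - missDetection P β γx γy)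

/-- Upper incomplete Gamma function `Γ(s, x) = ∫_x^∞ t^(s-1) e^(-t) dt`. -/
def upperGamma (s x : ℝ) : ℝ := ∫ t in Ioi x, t ^ (s - 1) * Real.exp (-t)

/-- Quantity averaged over `h` in the closed form for the interference ball model. -/
def ibmTerm (q : Params) (β r h : ℝ) : ℝ :=
  q.a ^ 2 * (1 - Real.exp (-(β * q.d₀ ^ q.α * h)))
    + r ^ 2 * (1 - Real.exp (-(β * q.d₀ ^ q.α * h * r ^ (-q.α))))
    - q.a ^ 2 * (1 - Real.exp (-(β * q.d₀ ^ q.α * h * q.a ^ (-q.α))))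
    + (β * q.d₀ ^ q.α * h) ^ (2 / q.α)
        * upperGamma (1 - 2 / q.α) (β * q.d₀ ^ q.α * h * r ^ (-q.α))
    - (β * q.d₀ ^ q.α * h) ^ (2 / q.α)
        * upperGamma (1 - 2 / q.α) (β * q.d₀ ^ q.α * h * q.a ^ (-q.α))

/-- Quantity averaged over `h` in the closed form for the physical model. -/
def phyTerm (q : Params) (β h : ℝ) : ℝ :=
  q.a ^ 2 * (1 - Real.exp (-(β * q.d₀ ^ q.α * h)))
    - q.a ^ 2 * (1 - Real.exp (-(β * q.d₀ ^ q.α * h * q.a ^ (-q.α))))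
    + (β * q.d₀ ^ q.α * h) ^ (2 / q.α) * Real.Gamma (1 - 2 / q.α)
    - (β * q.d₀ ^ q.α * h) ^ (2 / q.α)
        * upperGamma (1 - 2 / q.α) (β * q.d₀ ^ q.α * h * q.a ^ (-q.α))

/-- Quantity averaged over `h` in the closed form conditioned on no protocol-model outage. -/
def prmTerm (q : Params) (β r h : ℝ) : ℝ :=
  -(r ^ 2 * (1 - Real.exp (-(β * q.d₀ ^ q.α * h * r ^ (-q.α)))))
    + (β * q.d₀ ^ q.α * h) ^ (2 / q.α) * Real.Gamma (1 - 2 / q.α)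
    - (β * q.d₀ ^ q.α * h) ^ (2 / q.α)
        * upperGamma (1 - 2 / q.α) (β * q.d₀ ^ q.α * h * r ^ (-q.α))

/-- `1 - exp (-σ β d₀^α / (p c) - π lam E_h[F h])` with `h` exponential of mean `1`. -/
def closedForm (q : Params) (lam β : ℝ) (F : ℝ → ℝ) : ℝ :=
  1 - Real.exp (-(q.σ * β * q.d₀ ^ q.α) / (q.p * q.c)
    - Real.pi * lam * ∫ x, F x ∂(expMeasure 1))

/-- Closed form of `Pr[γ^IBM < β]`. -/
def ibmOutage (q : Params) (lam β r : ℝ) : ℝ := closedForm q lam β (ibmTerm q β r)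

/-- Closed form of `Pr[γ^PhyM < β]`. -/
def phyOutage (q : Params) (lam β : ℝ) : ℝ := closedForm q lam β (phyTerm q β)

/-- Closed form of `Pr[γ^PRM < β]`. -/
def prmOutage (lam r : ℝ) : ℝ := 1 - Real.exp (-(lam * Real.pi * r ^ 2))

/-- Closed form of `Pr[γ^PhyM < β | γ^PRM ≥ β]`. -/
def phyOutageGivenPRM (q : Params) (lam β r : ℝ) : ℝ := closedForm q lam β (prmTerm q β r)

end OutageModel

end

/-! Multiplying by the right constant, the event that the SINR is at least `β` becomes `h₀ ≥ t + ∑ₖ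
hₖ g(Xₖ)`, where `t = σ β d₀^α / (p c)` is the normalized noise and `g` the normalized, weighted
path loss (`le_sinr_iff`). Since `h₀` is a unit exponential independent of everything else,
integrating it out turns the probability of this event into a Laplace transform, the mean of `exp
(-(t + ∑ₖ hₖ g(Xₖ)))`. Averaging over the marks and then over the Poisson points gives `exp (-t - λ
E_h ∫ (1 - exp (-h g(x))) dx)` (`IsPoissonProcess.laplace`, `IsRayleighPoissonNetwork.laplace`,
`IsRayleighPoissonNetwork.coverage`). All exponentials live on `[0, ∞]`, so divergent sums and
infinite gains need no separate treatment.

In polar coordinates the plane integral reduces to integrals of `2 d (1 - exp (-s d^(-α)))`, whose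
antiderivative `ringPrimitive` involves the incomplete Gamma function. It has a finite limit at
infinity when `α > 2`, which is what the physical model requires.

Three choices of `g` suffice: the gain cut off outside a ball (interference ball model), the full
gain (physical model), and the gain set to `∞` on a ball. The last one yields the joint probability
of coverage in the protocol and physical models: an infinite gain forbids points in the ball, and
the exponent splits into a void part `λ π r²` and the rest. The accuracy indices then follow from
elementary set algebra, together with the fact that physical coverage implies coverage in the
interference ball model. -/

namespace OutageModel

open Filter Topology

/-! ### The decreasing exponential on `[0, ∞]` -/

/-- `t ↦ exp (-t)` on `[0, ∞]`, with value `0` at `∞`. -/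
noncomputable def expNeg (t : ℝ≥0∞) : ℝ≥0∞ := EReal.exp (-(t : EReal))

@[simp] lemma expNeg_zero : expNeg 0 = 1 := by simp [expNeg]

@[simp] lemma expNeg_top : expNeg ∞ = 0 := by simp [expNeg]

lemma expNeg_add (s t : ℝ≥0∞) : expNeg (s + t) = expNeg s * expNeg t := by
  unfold expNeg
  rw [EReal.coe_ennreal_add, EReal.neg_add (by simp) (by simp), sub_eq_add_neg, EReal.exp_add]

lemma expNeg_sum {ι : Type*} (s : Finset ι) (f : ι → ℝ≥0∞) :
    expNeg (∑ i ∈ s, f i) = ∏ i ∈ s, expNeg (f i) := by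
  classical
  induction s using Finset.induction_on with
  | empty => simp
  | insert i s hi ih => rw [Finset.sum_insert hi, Finset.prod_insert hi, expNeg_add, ih]

lemma expNeg_mul_natCast (c : ℝ≥0∞) (n : ℕ) : expNeg (c * n) = expNeg c ^ n := by
  have := expNeg_sum (Finset.range n) (fun _ => c)
  simpa [mul_comm] using this

lemma expNeg_antitone : Antitone expNeg := fun s t h => by
  unfold expNeg
  exact EReal.exp_monotone (EReal.neg_le_neg_iff.2 (EReal.coe_ennreal_le_coe_ennreal_iff.2 h))

lemma expNeg_le_one (t : ℝ≥0∞) : expNeg t ≤ 1 := by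
  simpa using expNeg_antitone (zero_le (a := t))

lemma expNeg_ne_top (t : ℝ≥0∞) : expNeg t ≠ ∞ :=
  ne_top_of_le_ne_top ENNReal.one_ne_top (expNeg_le_one t)

lemma continuous_expNeg : Continuous expNeg :=
  ENNReal.continuous_exp.comp (continuous_neg.comp continuous_coe_ennreal_ereal)

lemma measurable_expNeg : Measurable expNeg := continuous_expNeg.measurable

lemma expNeg_ofReal {x : ℝ} (hx : 0 ≤ x) :
    expNeg (ENNReal.ofReal x) = ENNReal.ofReal (Real.exp (-x)) := by
  unfold expNeg
  rw [EReal.coe_ennreal_ofReal, max_eq_left hx, ← EReal.coe_neg, EReal.exp_coe]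

/-- The inverse of `expNeg` on `[0, 1]`. -/
noncomputable def negLog (v : ℝ≥0∞) : ℝ≥0∞ := (-(ENNReal.log v)).toENNReal

lemma measurable_negLog : Measurable negLog :=
  (continuous_neg.comp ENNReal.continuous_log).measurable.ereal_toENNReal

lemma expNeg_negLog {v : ℝ≥0∞} (hv : v ≤ 1) : expNeg (negLog v) = v := by
  unfold expNeg negLog
  rw [EReal.coe_toENNReal (by simpa using hv), neg_neg, ENNReal.exp_log]

/-! ### Laplace functional of a Poisson process -/

/-- Probability generating function of the Poisson law. -/
lemma lintegral_pow_poissonMeasure (r : ℝ≥0) {v : ℝ≥0∞} (hv : v ≤ 1) :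
    ∫⁻ n, v ^ n ∂(poissonMeasure r) = expNeg (r * (1 - v)) := by
  lift v to ℝ≥0 using ne_top_of_le_ne_top ENNReal.one_ne_top hv
  have hv' : (v : ℝ) ≤ 1 := by exact_mod_cast hv
  have hsum : HasSum (fun n : ℕ => (v : ℝ) ^ n * (Real.exp (-r) * r ^ n / n.factorial))
      (Real.exp (-(r * (1 - v)))) := by
    have h := (NormedSpace.expSeries_div_hasSum_exp ((r : ℝ) * v)).mul_left (Real.exp (-r))
    rw [← Real.exp_eq_exp_ℝ, ← Real.exp_add] at h
    convert! h using 1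
    · ext n
      rw [mul_pow]
      ring
    · ring_nf
  have hexp : ((r : ℝ≥0∞) * (1 - v)) = ENNReal.ofReal (r * (1 - v)) := by
    rw [ENNReal.ofReal_mul (by positivity), ENNReal.ofReal_sub _ (by positivity)]
    simp
  rw [lintegral_countable', hexp, expNeg_ofReal (mul_nonneg r.coe_nonneg (by linarith)),
    ← hsum.tsum_eq, ENNReal.ofReal_tsum_of_nonneg (fun n => by positivity) hsum.summable]
  refine tsum_congr fun n => ?_
  rw [poissonMeasure_singleton, ENNReal.ofReal_mul (by positivity),
    ENNReal.ofReal_pow (by positivity)]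
  simp

lemma pointCount_eq_tsum {E : Type*} (x : ℕ → E) (B : Set E) :
    ((pointCount x B : ℕ∞) : ℝ≥0∞) = ∑' k, B.indicator 1 (x k) := by
  rw [pointCount, ← ENNReal.tsum_set_one, tsum_subtype {k | x k ∈ B} (fun _ => (1 : ℝ≥0∞))]
  rfl

section Laplace

variable {Ω E : Type*} [MeasurableSpace Ω] [MeasurableSpace E] {P : Measure Ω}
  {X : ℕ → Ω → E} {Λ : Measure E}

/-- The count is a series of measurable indicators in `[0, ∞]`; as `ℕ∞` is countable, checking
singletons brings this back to `ℕ∞`. -/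
lemma IsPoissonProcess.measurable_pointCount (hX : IsPoissonProcess P X Λ) {B : Set E}
    (hB : MeasurableSet B) : Measurable fun ω => pointCount (fun k => X k ω) B := by
  have h : Measurable fun ω => ((pointCount (fun k => X k ω) B : ℕ∞) : ℝ≥0∞) := by
    simp_rw [pointCount_eq_tsum]
    exact Measurable.tsum fun k =>
      (measurable_one.indicator hB).comp (hX.measurable k)
  refine measurable_to_countable' fun n => ?_
  have : (fun ω => pointCount (fun k => X k ω) B) ⁻¹' {n}
      = (fun ω => ((pointCount (fun k => X k ω) B : ℕ∞) : ℝ≥0∞)) ⁻¹' {(n : ℝ≥0∞)} := by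
    ext ω
    simp
  rw [this]
  exact h (measurableSet_singleton _)

lemma IsPoissonProcess.lintegral_expNeg_mul_pointCount [IsProbabilityMeasure P]
    (hX : IsPoissonProcess P X Λ) {B : Set E} (hB : MeasurableSet B) (hΛ : Λ B ≠ ∞)
    (c : ℝ≥0∞) :
    ∫⁻ ω, expNeg (c * (pointCount (fun k => X k ω) B : ℕ∞)) ∂P
      = expNeg (Λ B * (1 - expNeg c)) := by
  have hN := hX.measurable_pointCount hB
  set N := fun ω => pointCount (fun k => X k ω) B with hNdef
  have hlaw : P.map N = (poissonMeasure (Λ B).toNNReal).map (fun n : ℕ => (n : ℕ∞)) := by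
    have hcast : Measurable (fun n : ℕ => (n : ℕ∞)) := .of_discrete
    have : IsProbabilityMeasure (P.map N) := Measure.isProbabilityMeasure_map hN.aemeasurable
    have : IsProbabilityMeasure ((poissonMeasure (Λ B).toNNReal).map (fun n : ℕ => (n : ℕ∞))) :=
      Measure.isProbabilityMeasure_map hcast.aemeasurable
    have hnat : ∀ n : ℕ, P.map N {(n : ℕ∞)}
        = (poissonMeasure (Λ B).toNNReal).map (fun n : ℕ => (n : ℕ∞)) {(n : ℕ∞)} := fun n => by
      rw [Measure.map_apply hN (measurableSet_singleton _),
        Measure.map_apply hcast (measurableSet_singleton _)]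
      have : (fun n : ℕ => (n : ℕ∞)) ⁻¹' {(n : ℕ∞)} = {n} := by
        ext m
        simp
      rw [this, ← hX.count_law B hB hΛ n]
      rfl
    -- `count_law` speaks of finite counts only; the mass at `⊤` is what remains, both laws being
    -- probability measures.
    have htop : ({⊤} : Set ℕ∞) = (⋃ n : ℕ, {(n : ℕ∞)})ᶜ := by
      ext m
      induction m using ENat.recTopCoe <;> simp
    have hU : MeasurableSet (⋃ n : ℕ, {(n : ℕ∞)}) := .of_discrete
    have hdisj : Pairwise (Function.onFun Disjoint fun n : ℕ => ({(n : ℕ∞)} : Set ℕ∞)) :=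
      fun m n hmn => by simpa [Function.onFun] using hmn
    refine Measure.ext_of_singleton fun m => ?_
    induction m using ENat.recTopCoe with
    | coe n => exact hnat n
    | top =>
      rw [htop, prob_compl_eq_one_sub hU, prob_compl_eq_one_sub hU,
        measure_iUnion hdisj (fun _ => measurableSet_singleton _),
        measure_iUnion hdisj (fun _ => measurableSet_singleton _)]
      simp_rw [hnat]
  calc ∫⁻ ω, expNeg (c * (N ω : ℝ≥0∞)) ∂P
      = ∫⁻ m : ℕ∞, expNeg (c * (m : ℝ≥0∞)) ∂(P.map N) :=
        (lintegral_map (f := fun m : ℕ∞ => expNeg (c * (m : ℝ≥0∞))) .of_discrete hN).symm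
    _ = ∫⁻ n : ℕ, expNeg (c * (((n : ℕ∞)) : ℝ≥0∞)) ∂(poissonMeasure (Λ B).toNNReal) := by
        rw [hlaw, lintegral_map .of_discrete .of_discrete]
    _ = ∫⁻ n : ℕ, expNeg c ^ n ∂(poissonMeasure (Λ B).toNNReal) := by
        refine lintegral_congr fun n => ?_
        rw [← expNeg_mul_natCast]
        simp
    _ = expNeg (Λ B * (1 - expNeg c)) := by
        rw [lintegral_pow_poissonMeasure _ (expNeg_le_one c), ENNReal.coe_toNNReal hΛ]

lemma IsPoissonProcess.laplace_of_disjoint [IsProbabilityMeasure P]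
    (hX : IsPoissonProcess P X Λ) {m : ℕ} {B : Fin m → Set E} (hB : ∀ i, MeasurableSet (B i))
    (hd : Pairwise (Function.onFun Disjoint B)) (hΛ : ∀ i, Λ (B i) ≠ ∞) (c : Fin m → ℝ≥0∞) :
    ∫⁻ ω, expNeg (∑ i, c i * (pointCount (fun k => X k ω) (B i) : ℕ∞)) ∂P
      = expNeg (∑ i, Λ (B i) * (1 - expNeg (c i))) := by
  simp_rw [expNeg_sum]
  have hind := (hX.count_indep m B hB hd).comp
    (fun i (n : ℕ∞) => expNeg (c i * (n : ℝ≥0∞))) (fun i => .of_discrete)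
  have := lintegral_prod_eq_prod_lintegral_of_indepFun Finset.univ _ hind
    (fun i => Measurable.of_discrete.comp (hX.measurable_pointCount (hB i)))
  simp only [Function.comp_apply] at this
  rw [this]
  exact Finset.prod_congr rfl fun i _ => hX.lintegral_expNeg_mul_pointCount (hB i) (hΛ i) (c i)

/-- Only the fibres over nonzero values matter: the zero fibre may have infinite intensity but
contributes nothing to either side. -/
lemma IsPoissonProcess.laplace_simpleFunc [IsProbabilityMeasure P]
    (hX : IsPoissonProcess P X Λ) (f : SimpleFunc E ℝ≥0∞)
    (hf : ∀ c, c ≠ 0 → Λ (f ⁻¹' {c}) ≠ ∞) :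
    ∫⁻ ω, expNeg (∑' k, f (X k ω)) ∂P = expNeg (∫⁻ x, (1 - expNeg (f x)) ∂Λ) := by
  classical
  let S := f.range.filter (· ≠ 0)
  let e := S.equivFin
  let c : Fin S.card → ℝ≥0∞ := fun i => (e.symm i : ℝ≥0∞)
  let B : Fin S.card → Set E := fun i => f ⁻¹' {c i}
  have hc : ∀ i, c i ≠ 0 := fun i => (Finset.mem_filter.1 (e.symm i).2).2
  have hB : ∀ i, MeasurableSet (B i) := fun i => f.measurableSet_fiber _
  have hcinj : Function.Injective c := Subtype.val_injective.comp e.symm.injective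
  have hd : Pairwise (Function.onFun Disjoint B) := fun i j hij =>
    Disjoint.preimage _ (by simpa using hcinj.ne hij)
  -- Used twice: with the identity for the sum over points, and with `1 - expNeg` for the intensity
  -- integral.
  have key : ∀ (φ : ℝ≥0∞ → ℝ≥0∞), φ 0 = 0 → ∀ x,
      φ (f x) = ∑ i, φ (c i) * (B i).indicator 1 x := fun φ hφ x => by
    by_cases hx : f x = 0
    · rw [hx, hφ]
      symm
      refine Finset.sum_eq_zero fun i _ => ?_
      rw [indicator_of_notMem, mul_zero]
      intro hi
      exact hc i (by rw [← hx]; exact hi.symm)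
    · have hmem : f x ∈ S := Finset.mem_filter.2 ⟨f.mem_range_self x, hx⟩
      have hci : c (e ⟨f x, hmem⟩) = f x := by simp [c]
      rw [Finset.sum_eq_single (e ⟨f x, hmem⟩)]
      · rw [hci, indicator_of_mem (by simp [B, hci])]
        simp
      · intro j _ hj
        rw [indicator_of_notMem, mul_zero]
        intro hjx
        exact hj (hcinj (by rw [hci]; exact hjx.symm))
      · simp
  have hleft : ∀ ω, ∑' k, f (X k ω)
      = ∑ i, c i * (pointCount (fun k => X k ω) (B i) : ℕ∞) := fun ω => by
    simp_rw [pointCount_eq_tsum, ← ENNReal.tsum_mul_left]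
    rw [← Summable.tsum_finsetSum (fun _ _ => ENNReal.summable)]
    exact tsum_congr fun k => key id rfl _
  have hright : ∫⁻ x, (1 - expNeg (f x)) ∂Λ = ∑ i, Λ (B i) * (1 - expNeg (c i)) := by
    simp_rw [key (fun t => 1 - expNeg t) (by simp)]
    rw [lintegral_finsetSum _ fun i _ => (measurable_one.indicator (hB i)).const_mul _]
    refine Finset.sum_congr rfl fun i _ => ?_
    rw [lintegral_const_mul _ (measurable_one.indicator (hB i)), lintegral_indicator_one (hB i),
      mul_comm]
  simp_rw [hleft]
  rw [hright, hX.laplace_of_disjoint hB hd (fun i => hf _ (hc i)) c]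

/-- Laplace functional of a Poisson process. -/
theorem IsPoissonProcess.laplace [IsProbabilityMeasure P] [SigmaFinite Λ]
    (hX : IsPoissonProcess P X Λ) {f : E → ℝ≥0∞} (hf : Measurable f) :
    ∫⁻ ω, expNeg (∑' k, f (X k ω)) ∂P = expNeg (∫⁻ x, (1 - expNeg (f x)) ∂Λ) := by
  -- Restricting to spanning sets gives the nonzero fibres finite intensity while keeping the
  -- approximation monotone.
  let g : ℕ → SimpleFunc E ℝ≥0∞ := fun n => (SimpleFunc.eapprox f n).restrict (spanningSets Λ n)
  have hg : ∀ n x, g n x = (spanningSets Λ n).indicator (SimpleFunc.eapprox f n) x := fun n x =>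
    SimpleFunc.restrict_apply _ (measurableSet_spanningSets Λ n) x
  have hmono : ∀ x, Monotone fun n => g n x := fun x m n hmn => by
    simp only [hg]
    exact (indicator_le_indicator (SimpleFunc.monotone_eapprox f hmn x)).trans
      (indicator_le_indicator_of_subset (monotone_spanningSets Λ hmn) (fun _ => zero_le) x)
  have htend : ∀ x, Tendsto (fun n => g n x) atTop (𝓝 (f x)) := fun x => by
    have h := tendsto_atTop_iSup (fun m n hmn => SimpleFunc.monotone_eapprox f hmn x :
      Monotone fun n => SimpleFunc.eapprox f n x)
    rw [SimpleFunc.iSup_eapprox_apply hf] at h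
    refine h.congr' ?_
    filter_upwards [eventually_ge_atTop (spanningSetsIndex Λ x)] with n hn
    rw [hg, indicator_of_mem (monotone_spanningSets Λ hn (mem_spanningSetsIndex Λ x))]
  have hsimple : ∀ n, ∫⁻ ω, expNeg (∑' k, g n (X k ω)) ∂P
      = expNeg (∫⁻ x, (1 - expNeg (g n x)) ∂Λ) := fun n => by
    refine hX.laplace_simpleFunc (g n) fun c hc => ?_
    refine ne_top_of_le_ne_top (measure_spanningSets_lt_top Λ n).ne (measure_mono fun x hx => ?_)
    by_contra hxn
    refine hc ?_
    rw [← (show g n x = c from hx), hg, indicator_of_notMem hxn]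
  have hleft : Tendsto (fun n => ∫⁻ ω, expNeg (∑' k, g n (X k ω)) ∂P) atTop
      (𝓝 (∫⁻ ω, expNeg (∑' k, f (X k ω)) ∂P)) := by
    refine tendsto_lintegral_of_dominated_convergence (fun _ => 1) (fun n => ?_)
      (fun n => .of_forall fun ω => expNeg_le_one _) (by simp) (.of_forall fun ω => ?_)
    · exact measurable_expNeg.comp (Measurable.tsum fun k =>
        (g n).measurable.comp (hX.measurable k))
    · refine (continuous_expNeg.tendsto _).comp ?_
      -- As integrals against counting measure, the series converge by monotone convergence, even to
      -- `∞`.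
      simp_rw [← lintegral_count]
      exact lintegral_tendsto_of_tendsto_of_monotone (fun n => Measurable.of_discrete.aemeasurable)
        (.of_forall fun k => hmono _) (.of_forall fun k => htend _)
  have hright : Tendsto (fun n => expNeg (∫⁻ x, (1 - expNeg (g n x)) ∂Λ)) atTop
      (𝓝 (expNeg (∫⁻ x, (1 - expNeg (f x)) ∂Λ))) := by
    refine (continuous_expNeg.tendsto _).comp ?_
    refine lintegral_tendsto_of_tendsto_of_monotone
      (fun n => (measurable_const.sub (measurable_expNeg.comp (g n).measurable)).aemeasurable)
      (.of_forall fun x m n hmn => tsub_le_tsub_left (expNeg_antitone (hmono x hmn)) 1)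
      (.of_forall fun x => ?_)
    exact ENNReal.Tendsto.sub tendsto_const_nhds ((continuous_expNeg.tendsto _).comp (htend x))
      (.inl ENNReal.one_ne_top)
  simp_rw [hsimple] at hleft
  exact tendsto_nhds_unique hleft hright

end Laplace

/-! ### Exponential marks -/

instance instIsProbabilityMeasureExpMeasureOne : IsProbabilityMeasure (expMeasure 1) :=
  isProbabilityMeasure_expMeasure one_pos

instance instNullSingletonClassExpMeasure (r : ℝ) : NullSingletonClass (expMeasure r) := by
  unfold expMeasure gammaMeasure
  infer_instance

lemma expMeasure_one_ofReal_ge (t : ℝ≥0∞) :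
    expMeasure 1 {u | t ≤ ENNReal.ofReal u} = expNeg t := by
  induction t with
  | top => simp
  | coe t =>
    rcases eq_or_ne t 0 with rfl | ht
    · simp
    have hset : {u | (t : ℝ≥0∞) ≤ ENNReal.ofReal u} = Ici (t : ℝ) := by
      ext u
      rw [mem_ofPred_eq, ← ENNReal.ofReal_coe_nnreal,
        ENNReal.ofReal_le_ofReal_iff' , mem_Ici, or_iff_left]
      simpa [not_le] using pos_iff_ne_zero.2 ht
    have hcdf := cdf_expMeasure_eq one_pos (t : ℝ)
    rw [if_pos t.coe_nonneg, one_mul, cdf_eq_real] at hcdf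
    rw [hset, measure_congr Ioi_ae_eq_Ici.symm, ← ENNReal.ofReal_coe_nnreal,
      expNeg_ofReal t.coe_nonneg, ← compl_Iic,
      ← ofReal_measureReal, probReal_compl_eq_one_sub measurableSet_Iic, hcdf]
    simp

lemma ae_pos_expMeasure_one : ∀ᵐ u ∂(expMeasure 1), 0 < u := by
  have h : expMeasure 1 (Iic 0) = 0 := by
    have hcdf := cdf_expMeasure_eq one_pos (0 : ℝ)
    rw [if_pos le_rfl, cdf_eq_real] at hcdf
    rw [← ofReal_measureReal, hcdf]
    simp
  rw [ae_iff]
  convert h using 2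
  ext u
  simp

/-- Laplace transform of the unit exponential law, on `[0, ∞]`. -/
noncomputable def expLaplace (t : ℝ≥0∞) : ℝ≥0∞ :=
  ∫⁻ u, expNeg (ENNReal.ofReal u * t) ∂(expMeasure 1)

lemma expLaplace_le_one (t : ℝ≥0∞) : expLaplace t ≤ 1 := by
  calc expLaplace t ≤ ∫⁻ _, 1 ∂(expMeasure 1) := lintegral_mono fun _ => expNeg_le_one _
    _ = 1 := by simp

lemma measurable_expLaplace : Measurable expLaplace := by
  refine Measurable.lintegral_prod_right (f := fun t u => expNeg (ENNReal.ofReal u * t)) ?_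
  exact measurable_expNeg.comp ((ENNReal.measurable_ofReal.comp measurable_snd).mul measurable_fst)

section Marks

variable {Ω : Type*} [MeasurableSpace Ω] {P : Measure Ω} [IsProbabilityMeasure P]

/-- Independence factorizes the finite partial sums, and bounded convergence gives the series.
Writing the product through `negLog` keeps it in the form `expNeg` of a sum over points, to which
the Laplace functional of the positions applies. -/
lemma lintegral_expNeg_tsum_exponential {h : ℕ → Ω → ℝ} (hm : ∀ k, Measurable (h k))
    (hlaw : ∀ k, P.map (h k) = expMeasure 1) (hind : iIndepFun h P) (t : ℕ → ℝ≥0∞) :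
    ∫⁻ ω, expNeg (∑' k, ENNReal.ofReal (h k ω) * t k) ∂P
      = expNeg (∑' k, negLog (expLaplace (t k))) := by
  have hφ : ∀ k, Measurable fun u : ℝ => expNeg (ENNReal.ofReal u * t k) := fun k =>
    measurable_expNeg.comp (ENNReal.measurable_ofReal.mul_const _)
  have hfin : ∀ n, ∫⁻ ω, expNeg (∑ k ∈ Finset.range n, ENNReal.ofReal (h k ω) * t k) ∂P
      = expNeg (∑ k ∈ Finset.range n, negLog (expLaplace (t k))) := fun n => by
    simp_rw [expNeg_sum, expNeg_negLog (expLaplace_le_one _)]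
    have := lintegral_prod_eq_prod_lintegral_of_indepFun (Finset.range n) _ (hind.comp _ hφ)
      (fun k => (hφ k).comp (hm k))
    simp only [Function.comp_apply] at this
    rw [this]
    refine Finset.prod_congr rfl fun k _ => ?_
    rw [expLaplace, ← hlaw k, lintegral_map (hφ k) (hm k)]
  have hleft : Tendsto
      (fun n => ∫⁻ ω, expNeg (∑ k ∈ Finset.range n, ENNReal.ofReal (h k ω) * t k) ∂P) atTop
      (𝓝 (∫⁻ ω, expNeg (∑' k, ENNReal.ofReal (h k ω) * t k) ∂P)) := by
    refine tendsto_lintegral_of_dominated_convergence (fun _ => 1) (fun n => ?_)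
      (fun n => .of_forall fun ω => expNeg_le_one _) (by simp) (.of_forall fun ω => ?_)
    · exact measurable_expNeg.comp (Finset.measurable_fun_sum _ fun k _ =>
        (ENNReal.measurable_ofReal.comp (hm k)).mul_const _)
    · exact (continuous_expNeg.tendsto _).comp (ENNReal.tendsto_nat_tsum _)
  simp_rw [hfin] at hleft
  exact tendsto_nhds_unique hleft
    ((continuous_expNeg.tendsto _).comp (ENNReal.tendsto_nat_tsum _))

variable {lam : ℝ} {X : ℕ → Ω → Plane} {h₀ : Ω → ℝ} {h : ℕ → Ω → ℝ}

/-- Laplace transform of the interference created by the marked process. -/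
theorem IsRayleighPoissonNetwork.laplace (hnet : IsRayleighPoissonNetwork P lam X h₀ h)
    {g : Plane → ℝ≥0∞} (hg : Measurable g) :
    ∫⁻ ω, expNeg (∑' k, ENNReal.ofReal (h k ω) * g (X k ω)) ∂P
      = expNeg (ENNReal.ofReal lam * ∫⁻ x, (1 - expLaplace (g x))) := by
  have hX : Measurable fun (ω : Ω) (k : ℕ) => X k ω :=
    measurable_pi_lambda _ hnet.poisson.measurable
  have hh : Measurable fun (ω : Ω) (k : ℕ) => h k ω := measurable_pi_lambda _ hnet.measurable_h
  have hF : Measurable fun z : (ℕ → Plane) × (ℕ → ℝ) =>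
      expNeg (∑' k, ENNReal.ofReal (z.2 k) * g (z.1 k)) :=
    measurable_expNeg.comp (Measurable.tsum fun k =>
      (ENNReal.measurable_ofReal.comp ((measurable_pi_apply k).comp measurable_snd)).mul
        (hg.comp ((measurable_pi_apply k).comp measurable_fst)))
  have hjoint := (indepFun_iff_map_prod_eq_prod_map_map hX.aemeasurable hh.aemeasurable).1
    hnet.indep_X_h
  have : IsProbabilityMeasure (P.map fun (ω : Ω) (k : ℕ) => h k ω) :=
    Measure.isProbabilityMeasure_map hh.aemeasurable
  have hf : Measurable fun x => negLog (expLaplace (g x)) :=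
    measurable_negLog.comp (measurable_expLaplace.comp hg)
  -- The joint law of positions and marks is a product, so the marks are averaged first with the
  -- positions frozen.
  calc ∫⁻ ω, expNeg (∑' k, ENNReal.ofReal (h k ω) * g (X k ω)) ∂P
      = ∫⁻ z, expNeg (∑' k, ENNReal.ofReal (z.2 k) * g (z.1 k))
          ∂(P.map fun ω => ((fun k => X k ω), (fun k => h k ω))) :=
        (lintegral_map hF (hX.prodMk hh)).symm
    _ = ∫⁻ x, ∫⁻ y, expNeg (∑' k, ENNReal.ofReal (y k) * g (x k))
          ∂(P.map fun (ω : Ω) (k : ℕ) => h k ω) ∂(P.map fun (ω : Ω) (k : ℕ) => X k ω) := by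
        rw [hjoint, lintegral_prod _ hF.aemeasurable]
    _ = ∫⁻ x, expNeg (∑' k, negLog (expLaplace (g (x k))))
          ∂(P.map fun (ω : Ω) (k : ℕ) => X k ω) := by
        refine lintegral_congr fun x => ?_
        refine (lintegral_map (hF.comp (measurable_prodMk_left (x := x))) hh).trans ?_
        exact lintegral_expNeg_tsum_exponential hnet.measurable_h hnet.law_h hnet.indep_h
          fun k => g (x k)
    _ = ∫⁻ ω, expNeg (∑' k, negLog (expLaplace (g (X k ω)))) ∂P := by
        rw [lintegral_map _ hX]
        exact measurable_expNeg.comp (Measurable.tsum fun k => hf.comp (measurable_pi_apply k))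
    _ = expNeg (ENNReal.ofReal lam * ∫⁻ x, (1 - expLaplace (g x))) := by
        have : SigmaFinite (ENNReal.ofReal lam • (volume : Measure Plane)) := by
          -- `ENNReal.ofReal lam` is by definition the cast of `lam.toNNReal`, hence a finite
          -- scalar.
          exact SMul.sigmaFinite lam.toNNReal
        rw [hnet.poisson.laplace hf, lintegral_smul_measure]
        simp_rw [expNeg_negLog (expLaplace_le_one _), smul_eq_mul]

lemma lintegral_one_sub_expLaplace {g : Plane → ℝ≥0∞} (hg : Measurable g) :
    ∫⁻ x, (1 - expLaplace (g x))
      = ∫⁻ u, ∫⁻ x, (1 - expNeg (ENNReal.ofReal u * g x)) ∂(volume : Measure Plane)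
          ∂(expMeasure 1) := by
  have hm : Measurable fun z : Plane × ℝ => expNeg (ENNReal.ofReal z.2 * g z.1) :=
    measurable_expNeg.comp
      ((ENNReal.measurable_ofReal.comp measurable_snd).mul (hg.comp measurable_fst))
  have hm' : Measurable fun z : Plane × ℝ => 1 - expNeg (ENNReal.ofReal z.2 * g z.1) :=
    measurable_const.sub hm
  rw [← lintegral_lintegral_swap
    (f := fun x u => 1 - expNeg (ENNReal.ofReal u * g x)) hm'.aemeasurable]
  refine lintegral_congr fun x => ?_
  have hmx : Measurable fun u : ℝ => expNeg (ENNReal.ofReal u * g x) :=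
    hm.comp measurable_prodMk_left
  rw [lintegral_sub hmx
    (ne_top_of_le_ne_top ENNReal.one_ne_top (expLaplace_le_one (g x)))
    (.of_forall fun u => expNeg_le_one _)]
  simp [expLaplace]

/-- Probability that the fading of the intended link exceeds noise plus weighted interference. -/
theorem IsRayleighPoissonNetwork.coverage (hnet : IsRayleighPoissonNetwork P lam X h₀ h)
    {g : Plane → ℝ≥0∞} (hg : Measurable g) (t : ℝ≥0∞) :
    P {ω | t + ∑' k, ENNReal.ofReal (h k ω) * g (X k ω) ≤ ENNReal.ofReal (h₀ ω)}
      = expNeg (t + ENNReal.ofReal lam *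
          ∫⁻ u, ∫⁻ x, (1 - expNeg (ENNReal.ofReal u * g x)) ∂(volume : Measure Plane)
            ∂(expMeasure 1)) := by
  let V : Ω → (ℕ → Plane) × (ℕ → ℝ) := fun ω => ((fun k => X k ω), (fun k => h k ω))
  have hV : Measurable V := (measurable_pi_lambda _ hnet.poisson.measurable).prodMk
    (measurable_pi_lambda _ hnet.measurable_h)
  let T : (ℕ → Plane) × (ℕ → ℝ) → ℝ≥0∞ := fun z =>
    t + ∑' k, ENNReal.ofReal (z.2 k) * g (z.1 k)
  have hT : Measurable T := measurable_const.add (Measurable.tsum fun k =>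
    (ENNReal.measurable_ofReal.comp ((measurable_pi_apply k).comp measurable_snd)).mul
      (hg.comp ((measurable_pi_apply k).comp measurable_fst)))
  have hjoint := (indepFun_iff_map_prod_eq_prod_map_map hnet.measurable_h₀.aemeasurable
    hV.aemeasurable).1 hnet.indep_h₀
  have : IsProbabilityMeasure (P.map V) := Measure.isProbabilityMeasure_map hV.aemeasurable
  have hS : MeasurableSet {z : ℝ × ((ℕ → Plane) × (ℕ → ℝ)) | T z.2 ≤ ENNReal.ofReal z.1} :=
    measurableSet_le (hT.comp measurable_snd) (ENNReal.measurable_ofReal.comp measurable_fst)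
  -- Given positions and marks, `h₀` exceeds the level `T` with probability `expNeg T`.
  calc P {ω | T (V ω) ≤ ENNReal.ofReal (h₀ ω)}
      = P.map (fun ω => (h₀ ω, V ω)) {z | T z.2 ≤ ENNReal.ofReal z.1} :=
        (Measure.map_apply (hnet.measurable_h₀.prodMk hV) hS).symm
    _ = ∫⁻ y, expMeasure 1 {u | T y ≤ ENNReal.ofReal u} ∂(P.map V) := by
        rw [hjoint, hnet.law_h₀, Measure.prod_apply_symm hS]
        rfl
    _ = ∫⁻ ω, expNeg (T (V ω)) ∂P := by
        simp_rw [expMeasure_one_ofReal_ge]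
        exact lintegral_map (measurable_expNeg.comp hT) hV
    _ = expNeg t * ∫⁻ ω, expNeg (∑' k, ENNReal.ofReal (h k ω) * g (X k ω)) ∂P := by
        simp only [T, V, expNeg_add]
        rw [lintegral_const_mul' _ _ (expNeg_ne_top t)]
    _ = _ := by
        rw [hnet.laplace hg, lintegral_one_sub_expLaplace hg, expNeg_add]

end Marks

/-! ### Radial integrals -/

/-- Integration in polar coordinates of a radial function on the plane. -/
lemma lintegral_plane_norm {F : ℝ → ℝ≥0∞} (hF : Measurable F) :
    ∫⁻ x : Plane, F ‖x‖ = ENNReal.ofReal Real.pi * ∫⁻ r in Ioi 0, ENNReal.ofReal (2 * r) * F r := by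
  have hdim : Module.finrank ℝ Plane = 2 := by simp
  have hF' : Measurable fun r : Ioi (0 : ℝ) => F r := hF.comp measurable_subtype_coe
  calc ∫⁻ x : Plane, F ‖x‖
      = ∫⁻ x : ({(0)}ᶜ : Set Plane), F ‖x.1‖ ∂((volume : Measure Plane).comap (↑)) := by
        rw [lintegral_subtype_comap (measurableSet_singleton _).compl fun x : Plane => F ‖x‖,
          restrict_compl_singleton]
    _ = ∫⁻ x, F x.2 ∂((volume : Measure Plane).toSphere.prod (.volumeIoiPow 1)) := by
        have h := (volume : Measure Plane).measurePreserving_homeomorphUnitSphereProd.lintegral_comp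
          (hF'.comp measurable_snd)
        rw [hdim] at h
        simpa using h
    _ = (volume : Measure Plane).toSphere univ
          * ∫⁻ r : Ioi (0 : ℝ), F r ∂(Measure.volumeIoiPow 1) := by
        refine (lintegral_prod _ (hF'.comp measurable_snd).aemeasurable).trans ?_
        simp [mul_comm]
    -- The unit circle has mass `2π`; the factor `2` goes into the integrand, where `2 r` is the
    -- derivative of `r²`.
    _ = _ := by
        rw [Measure.toSphere_apply_univ, hdim, EuclideanSpace.volume_ball_fin_two,
          Measure.volumeIoiPow, lintegral_withDensity_eq_lintegral_mul _ (by fun_prop) hF']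
        simp only [pow_one, Pi.mul_apply]
        rw [lintegral_subtype_comap measurableSet_Ioi fun r : ℝ => ENNReal.ofReal r * F r]
        simp_rw [ENNReal.ofReal_mul (zero_le_two (α := ℝ)), mul_assoc]
        rw [lintegral_const_mul _ (by fun_prop)]
        simp
        ring

lemma lintegral_Ioc_two_mul {a : ℝ} (ha : 0 ≤ a) :
    ∫⁻ r in Ioc 0 a, ENNReal.ofReal (2 * r) = ENNReal.ofReal (a ^ 2) := by
  rw [← ofReal_integral_eq_lintegral_ofReal, ← intervalIntegral.integral_of_le ha]
  · rw [intervalIntegral.integral_const_mul, integral_id]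
    ring_nf
  · exact (continuous_const.mul continuous_id).integrableOn_Ioc
  · filter_upwards [ae_restrict_mem measurableSet_Ioc] with r hr
    have := hr.1
    simp only [Pi.zero_apply]
    positivity

/-- A radial function that is constant on a disk. -/
lemma lintegral_Ioi_eq_disk_add {F : ℝ → ℝ≥0∞} {a : ℝ} (ha : 0 ≤ a) {c : ℝ≥0∞}
    (hc : ∀ r, r < a → F r = c) :
    ∫⁻ r in Ioi 0, ENNReal.ofReal (2 * r) * F r
      = ENNReal.ofReal (a ^ 2) * c + ∫⁻ r in Ioi a, ENNReal.ofReal (2 * r) * F r := by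
  rw [← Ioc_union_Ioi_eq_Ioi ha, lintegral_union measurableSet_Ioi
    (disjoint_left.2 fun r hr hr' => not_lt.2 hr.2 hr')]
  congr 1
  -- `hc` says nothing at `r = a`, where the path loss already switches; this endpoint is null.
  rw [← lintegral_Ioc_two_mul ha, ← lintegral_mul_const _ (by fun_prop),
    ← Measure.restrict_congr_set Ioo_ae_eq_Ioc]
  exact setLIntegral_congr_fun measurableSet_Ioo fun r hr => by rw [hc r hr.2]

/-! ### The upper incomplete Gamma function -/

/-- Since `x > 0` keeps away from the singularity at `0`, no sign of `s` is needed; `s = 1 - 2 / α`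
is not positive when `α ≤ 2`. -/
lemma integrableOn_upperGamma (s : ℝ) {x : ℝ} (hx : 0 < x) :
    IntegrableOn (fun t : ℝ => t ^ (s - 1) * Real.exp (-t)) (Ioi x) := by
  refine integrable_of_isBigO_exp_neg (b := 1 / 2) (by norm_num) ?_ ?_
  · intro t ht
    have ht0 : t ≠ 0 := (hx.trans_le ht).ne'
    exact ((Real.continuousAt_rpow_const t _ (.inl ht0)).mul
      (Real.continuous_exp.comp continuous_neg).continuousAt).continuousWithinAt
  · simpa only [mul_comm] using (Real.Gamma_integrand_isLittleO (s - 1)).isBigO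

lemma upperGamma_nonneg (s : ℝ) {x : ℝ} (hx : 0 ≤ x) : 0 ≤ upperGamma s x :=
  setIntegral_nonneg measurableSet_Ioi fun t ht => by
    have := hx.trans_lt ht
    positivity

/-- Near `x` the function is the constant `upperGamma s (x / 2)` minus an integral with moving upper
endpoint. -/
lemma hasDerivAt_upperGamma (s : ℝ) {x : ℝ} (hx : 0 < x) :
    HasDerivAt (upperGamma s) (-(x ^ (s - 1) * Real.exp (-x))) x := by
  have hcont : ContinuousOn (fun t : ℝ => t ^ (s - 1) * Real.exp (-t)) (Ioi 0) := fun t ht =>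
    ((Real.continuousAt_rpow_const t _ (.inl (ne_of_gt ht))).mul
      (Real.continuous_exp.comp continuous_neg).continuousAt).continuousWithinAt
  have hint : IntervalIntegrable (fun t : ℝ => t ^ (s - 1) * Real.exp (-t)) volume (x / 2) x := by
    refine (hcont.mono fun t ht => ?_).intervalIntegrable
    rw [uIcc_of_le (by linarith)] at ht
    exact lt_of_lt_of_le (by linarith) ht.1
  have hd := (intervalIntegral.integral_hasDerivAt_right hint
    (hcont.stronglyMeasurableAtFilter isOpen_Ioi x hx)
    (hcont.continuousAt (Ioi_mem_nhds hx))).const_sub (upperGamma s (x / 2))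
  refine hd.congr_of_eventuallyEq ?_
  filter_upwards [Ioi_mem_nhds hx] with y hy
  rw [upperGamma, upperGamma, ← intervalIntegral.integral_interval_add_Ioi
    (integrableOn_upperGamma s (half_pos hx)) (integrableOn_upperGamma s hy)]
  ring

lemma tendsto_upperGamma_zero {s : ℝ} (hs : 0 < s) :
    Tendsto (upperGamma s) (𝓝[>] 0) (𝓝 (Real.Gamma s)) := by
  have hI : IntegrableOn (fun t : ℝ => t ^ (s - 1) * Real.exp (-t)) (Ioi 0) := by
    simpa only [mul_comm] using Real.GammaIntegral_convergent hs
  have hG : Real.Gamma s = upperGamma s 0 := by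
    rw [Real.Gamma_eq_integral hs, upperGamma]
    simp only [mul_comm]
  have hprim : ContinuousOn (fun x => ∫ t in (0 : ℝ)..x, t ^ (s - 1) * Real.exp (-t))
      (Icc 0 1) := by
    have hI' : IntegrableOn (fun t : ℝ => t ^ (s - 1) * Real.exp (-t)) (uIcc 0 1) := by
      rw [uIcc_of_le zero_le_one, integrableOn_Icc_iff_integrableOn_Ioc]
      exact hI.mono_set Ioc_subset_Ioi_self
    simpa using intervalIntegral.continuousOn_primitive_interval hI'
  have h0 := (hprim 0 (by simp)).tendsto
  simp only [intervalIntegral.integral_same] at h0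
  have h1 : Tendsto (fun x => Real.Gamma s - ∫ t in (0 : ℝ)..x, t ^ (s - 1) * Real.exp (-t))
      (𝓝[>] 0) (𝓝 (Real.Gamma s - 0)) := by
    refine tendsto_const_nhds.sub (h0.mono_left ?_)
    rw [← nhdsWithin_Ioc_eq_nhdsGT (zero_lt_one (α := ℝ))]
    exact nhdsWithin_mono _ Ioc_subset_Icc_self
  rw [sub_zero] at h1
  refine h1.congr' ?_
  filter_upwards [self_mem_nhdsWithin] with x hx
  rw [hG, upperGamma, upperGamma, ← intervalIntegral.integral_interval_add_Ioi hI
    (integrableOn_upperGamma s hx)]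
  ring

/-! ### Integrals of `1 - exp (-s d ^ (-α))` over annuli -/

/-- An antiderivative of `d ↦ 2 d (1 - exp (-s d ^ (-α)))`. -/
noncomputable def ringPrimitive (α s d : ℝ) : ℝ :=
  d ^ 2 * (1 - Real.exp (-(s * d ^ (-α))))
    + s ^ (2 / α) * upperGamma (1 - 2 / α) (s * d ^ (-α))

/-- The derivative of the exponential in the first summand cancels that of the Gamma summand,
because `s^(2/α) (s d^(-α))^(-2/α) = d²`. -/
lemma hasDerivAt_ringPrimitive {α s d : ℝ} (hα : 0 < α) (hs : 0 < s) (hd : 0 < d) :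
    HasDerivAt (ringPrimitive α s) (2 * d * (1 - Real.exp (-(s * d ^ (-α))))) d := by
  have hu : 0 < s * d ^ (-α) := by positivity
  have h1 : HasDerivAt (fun d : ℝ => s * d ^ (-α)) (s * (-α * d ^ (-α - 1))) d :=
    (Real.hasDerivAt_rpow_const (.inl hd.ne')).const_mul s
  have h2 := (hasDerivAt_upperGamma (1 - 2 / α) hu).comp d h1
  have h3 := ((hasDerivAt_pow 2 d).mul (h1.neg.exp.const_sub 1)).add
    (h2.const_mul (s ^ (2 / α)))
  have hcancel : s ^ (2 / α) * (s * d ^ (-α)) ^ (1 - 2 / α - 1) = d ^ 2 := by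
    rw [show 1 - 2 / α - 1 = -(2 / α) by ring, Real.mul_rpow hs.le (by positivity), ← mul_assoc,
      ← Real.rpow_add hs, add_neg_cancel, Real.rpow_zero, one_mul, ← Real.rpow_mul hd.le,
      show -α * -(2 / α) = 2 by field_simp, Real.rpow_two]
  refine h3.congr_deriv ?_
  simp only [Pi.neg_apply]
  linear_combination (Real.exp (-(s * d ^ (-α))) * s * α * d ^ (-α - 1)) * hcancel

lemma one_sub_exp_neg_nonneg {x : ℝ} (hx : 0 ≤ x) : 0 ≤ 1 - Real.exp (-x) := by
  simpa using hx

lemma ringPrimitive_nonneg {α s d : ℝ} (hs : 0 ≤ s) (hd : 0 ≤ d) : 0 ≤ ringPrimitive α s d := by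
  have hu : 0 ≤ s * d ^ (-α) := by positivity
  have := one_sub_exp_neg_nonneg hu
  have := upperGamma_nonneg (1 - 2 / α) hu
  unfold ringPrimitive
  positivity

lemma ringPrimitive_mono {α s a b : ℝ} (hα : 0 < α) (hs : 0 < s) (ha : 0 < a) (hab : a ≤ b) :
    ringPrimitive α s a ≤ ringPrimitive α s b := by
  have hmono : MonotoneOn (ringPrimitive α s) (Ioi 0) := by
    refine monotoneOn_of_deriv_nonneg (convex_Ioi 0)
      (fun d hd => (hasDerivAt_ringPrimitive hα hs hd).continuousAt.continuousWithinAt)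
      (fun d hd => ?_) (fun d hd => ?_) <;> rw [interior_Ioi] at hd
    · exact (hasDerivAt_ringPrimitive hα hs hd).differentiableAt.differentiableWithinAt
    · have hd' : 0 < d := hd
      rw [(hasDerivAt_ringPrimitive hα hs hd).deriv]
      have := one_sub_exp_neg_nonneg (x := s * d ^ (-α)) (by positivity)
      positivity
  exact hmono ha (ha.trans_le hab) hab

/-- The first summand is at most `s d^(2-α)`, which vanishes as `α > 2`; in the second, the argument
of the incomplete Gamma function decreases to `0`, and `1 - 2 / α > 0` makes the limit a complete
Gamma value. -/
lemma tendsto_ringPrimitive {α s : ℝ} (hα : 2 < α) (hs : 0 < s) :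
    Tendsto (ringPrimitive α s) atTop (𝓝 (s ^ (2 / α) * Real.Gamma (1 - 2 / α))) := by
  have hα0 : 0 < α := by linarith
  have hu : Tendsto (fun d : ℝ => s * d ^ (-α)) atTop (𝓝 0) := by
    simpa using (tendsto_rpow_neg_atTop hα0).const_mul s
  have hu' : Tendsto (fun d : ℝ => s * d ^ (-α)) atTop (𝓝[>] 0) := by
    refine tendsto_nhdsWithin_iff.2 ⟨hu, ?_⟩
    filter_upwards [eventually_gt_atTop 0] with d hd
    have : 0 < s * d ^ (-α) := by positivity
    exact this
  have hσ : 0 < 1 - 2 / α := by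
    rw [sub_pos, div_lt_one hα0]
    exact hα
  have h1 : Tendsto (fun d : ℝ => d ^ 2 * (1 - Real.exp (-(s * d ^ (-α))))) atTop (𝓝 0) := by
    have hbound : Tendsto (fun d : ℝ => s * d ^ (-(α - 2))) atTop (𝓝 0) := by
      simpa using (tendsto_rpow_neg_atTop (sub_pos.2 hα)).const_mul s
    refine tendsto_of_tendsto_of_tendsto_of_le_of_le' tendsto_const_nhds hbound ?_ ?_
    · filter_upwards [eventually_gt_atTop 0] with d hd
      have := one_sub_exp_neg_nonneg (x := s * d ^ (-α)) (by positivity)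
      positivity
    · filter_upwards [eventually_gt_atTop 0] with d hd
      have hexp : 1 - Real.exp (-(s * d ^ (-α))) ≤ s * d ^ (-α) := by
        linarith [Real.add_one_le_exp (-(s * d ^ (-α)))]
      calc d ^ 2 * (1 - Real.exp (-(s * d ^ (-α)))) ≤ d ^ 2 * (s * d ^ (-α)) := by gcongr
        _ = s * d ^ (-(α - 2)) := by
          rw [show -(α - 2) = 2 + -α by ring, Real.rpow_add hd, Real.rpow_two]
          ring
  have h12 := h1.add (((tendsto_upperGamma_zero hσ).comp hu').const_mul (s ^ (2 / α)))
  rw [zero_add] at h12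
  exact h12

lemma ringPrimitive_le_limit {α s d : ℝ} (hα : 2 < α) (hs : 0 < s) (hd : 0 < d) :
    ringPrimitive α s d ≤ s ^ (2 / α) * Real.Gamma (1 - 2 / α) :=
  ge_of_tendsto (tendsto_ringPrimitive hα hs) <| by
    filter_upwards [eventually_ge_atTop d] with b hb
    exact ringPrimitive_mono (by linarith) hs hd hb

lemma lintegral_annulus {α s a b : ℝ} (hα : 0 < α) (hs : 0 < s) (ha : 0 < a) (hab : a ≤ b) :
    ∫⁻ d in Ioc a b, ENNReal.ofReal (2 * d) * ENNReal.ofReal (1 - Real.exp (-(s * d ^ (-α))))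
      = ENNReal.ofReal (ringPrimitive α s b - ringPrimitive α s a) := by
  have hcont : ContinuousOn (fun d : ℝ => 2 * d * (1 - Real.exp (-(s * d ^ (-α))))) (Icc a b) := by
    intro d hd
    have hd0 : d ≠ 0 := (ha.trans_le hd.1).ne'
    exact ((by fun_prop : ContinuousAt (fun d : ℝ => 2 * d) d).mul (continuousAt_const.sub
      (((continuousAt_const.mul
        (Real.continuousAt_rpow_const d _ (.inl hd0))).neg).rexp))).continuousWithinAt
  have hint : IntervalIntegrable (fun d : ℝ => 2 * d * (1 - Real.exp (-(s * d ^ (-α)))))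
      volume a b := by
    refine ContinuousOn.intervalIntegrable ?_
    rwa [uIcc_of_le hab]
  rw [← intervalIntegral.integral_eq_sub_of_hasDerivAt (fun d hd => hasDerivAt_ringPrimitive hα hs
    (by rw [uIcc_of_le hab] at hd; exact ha.trans_le hd.1)) hint,
    intervalIntegral.integral_of_le hab, ofReal_integral_eq_lintegral_ofReal hint.1]
  · refine setLIntegral_congr_fun measurableSet_Ioc fun d hd => ?_
    have : 0 < d := ha.trans hd.1
    exact (ENNReal.ofReal_mul (by positivity)).symm
  · filter_upwards [ae_restrict_mem measurableSet_Ioc] with d hd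
    have hd0 : 0 < d := ha.trans hd.1
    have := one_sub_exp_neg_nonneg (x := s * d ^ (-α)) (by positivity)
    simp only [Pi.zero_apply]
    positivity

lemma lintegral_tail {α s a : ℝ} (hα : 2 < α) (hs : 0 < s) (ha : 0 < a) :
    ∫⁻ d in Ioi a, ENNReal.ofReal (2 * d) * ENNReal.ofReal (1 - Real.exp (-(s * d ^ (-α))))
      = ENNReal.ofReal (s ^ (2 / α) * Real.Gamma (1 - 2 / α) - ringPrimitive α s a) := by
  have hα0 : 0 < α := by linarith
  have hderiv : ∀ d ∈ Ici a, HasDerivAt (ringPrimitive α s)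
      (2 * d * (1 - Real.exp (-(s * d ^ (-α))))) d := fun d hd =>
    hasDerivAt_ringPrimitive hα0 hs (ha.trans_le hd)
  have hpos : ∀ d ∈ Ioi a, 0 ≤ 2 * d * (1 - Real.exp (-(s * d ^ (-α)))) := fun d hd => by
    have hd0 : 0 < d := ha.trans hd
    have := one_sub_exp_neg_nonneg (x := s * d ^ (-α)) (by positivity)
    positivity
  rw [← integral_Ioi_of_hasDerivAt_of_nonneg' hderiv hpos (tendsto_ringPrimitive hα hs),
    ofReal_integral_eq_lintegral_ofReal
      (integrableOn_Ioi_deriv_of_nonneg' hderiv hpos (tendsto_ringPrimitive hα hs))]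
  · refine setLIntegral_congr_fun measurableSet_Ioi fun d hd => ?_
    have : 0 < d := ha.trans hd
    exact (ENNReal.ofReal_mul (by positivity)).symm
  · filter_upwards [ae_restrict_mem measurableSet_Ioi] with d hd using hpos d hd

/-- Against the exponential density this is the Gamma integral at `s + 1`. It provides the
dominating functions for the terms with an infinite tail. -/
lemma integrable_rpow_expMeasure_one {s : ℝ} (hs : 0 ≤ s) :
    Integrable (fun u : ℝ => u ^ s) (expMeasure 1) := by
  have hpdf : Measurable (gammaPDF 1 1) := (measurable_gammaPDFReal 1 1).ennreal_ofReal
  unfold expMeasure gammaMeasure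
  rw [integrable_withDensity_iff_integrable_smul' hpdf
    (.of_forall fun _ => ENNReal.ofReal_lt_top)]
  have h := Real.GammaIntegral_convergent (s := s + 1) (by linarith)
  rw [← integrable_indicator_iff measurableSet_Ioi] at h
  refine h.congr ?_
  filter_upwards [compl_mem_ae_iff.2 (measure_singleton (0 : ℝ))] with u hu
  rcases lt_or_gt_of_ne (show u ≠ 0 from hu) with h0 | h0
  · rw [indicator_of_notMem (by simpa using h0.le), gammaPDF_of_neg h0]
    simp
  · rw [indicator_of_mem (by simpa using h0), gammaPDF_of_nonneg h0.le]
    rw [ENNReal.toReal_ofReal (by positivity)]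
    simp

/-! ### Closed forms of the averaged void probabilities -/

/-- Gain of an interferer at distance `d`, in units in which the intended link has gain `1 / β`. -/
noncomputable def relGain (q : Params) (β d : ℝ) : ℝ≥0∞ :=
  ENNReal.ofReal (β * q.d₀ ^ q.α * pathLoss q.α q.a d)

lemma measurable_pathLoss (α a : ℝ) : Measurable (pathLoss α a) :=
  Measurable.ite measurableSet_Ici (measurable_id.pow_const _) measurable_const

lemma pathLoss_nonneg {α a d : ℝ} (ha : 0 ≤ a) : 0 ≤ pathLoss α a d := by
  unfold pathLoss
  split_ifs with h
  · exact Real.rpow_nonneg (ha.trans h) _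
  · exact zero_le_one

lemma measurable_relGain (q : Params) (β : ℝ) : Measurable (relGain q β) :=
  ((measurable_pathLoss q.α q.a).const_mul _).ennreal_ofReal

/-- The integrand `1 - exp (-u g)` at distance `d`, as a real number. -/
lemma one_sub_expNeg_relGain {q : Params} {β u d : ℝ} (hs : 0 < β * q.d₀ ^ q.α) (ha : 0 ≤ q.a)
    (hu : 0 ≤ u) :
    1 - expNeg (ENNReal.ofReal u * relGain q β d)
      = ENNReal.ofReal (1 - Real.exp (-(β * q.d₀ ^ q.α * u * pathLoss q.α q.a d))) := by
  have hl := pathLoss_nonneg (α := q.α) (d := d) ha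
  rw [relGain, ← ENNReal.ofReal_mul hu, expNeg_ofReal (by positivity), ← ENNReal.ofReal_one,
    ← ENNReal.ofReal_sub _ (Real.exp_pos _).le]
  ring_nf

section Terms

variable {q : Params} {β r u : ℝ}

/-- This grouping separates the disk of constant path loss from the annulus, so that both parts are
visibly nonnegative. -/
lemma ibmTerm_eq (q : Params) (β r u : ℝ) :
    ibmTerm q β r u = q.a ^ 2 * (1 - Real.exp (-(β * q.d₀ ^ q.α * u)))
      + (ringPrimitive q.α (β * q.d₀ ^ q.α * u) r
        - ringPrimitive q.α (β * q.d₀ ^ q.α * u) q.a) := by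
  unfold ibmTerm ringPrimitive
  ring

lemma phyTerm_eq (q : Params) (β u : ℝ) :
    phyTerm q β u = q.a ^ 2 * (1 - Real.exp (-(β * q.d₀ ^ q.α * u)))
      + ((β * q.d₀ ^ q.α * u) ^ (2 / q.α) * Real.Gamma (1 - 2 / q.α)
        - ringPrimitive q.α (β * q.d₀ ^ q.α * u) q.a) := by
  unfold phyTerm ringPrimitive
  ring

lemma prmTerm_eq (q : Params) (β r u : ℝ) :
    prmTerm q β r u = (β * q.d₀ ^ q.α * u) ^ (2 / q.α) * Real.Gamma (1 - 2 / q.α)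
        - ringPrimitive q.α (β * q.d₀ ^ q.α * u) r := by
  unfold prmTerm ringPrimitive
  ring

lemma setLIntegral_relGain {S : Set ℝ} (hS : MeasurableSet S) (hSa : S ⊆ Ici q.a)
    (hs : 0 < β * q.d₀ ^ q.α) (ha : 0 ≤ q.a) (hu : 0 ≤ u) :
    ∫⁻ d in S, ENNReal.ofReal (2 * d) * (1 - expNeg (ENNReal.ofReal u * relGain q β d))
      = ∫⁻ d in S, ENNReal.ofReal (2 * d)
          * ENNReal.ofReal (1 - Real.exp (-(β * q.d₀ ^ q.α * u * d ^ (-q.α)))) :=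
  setLIntegral_congr_fun hS fun d hd => by
    simp only [one_sub_expNeg_relGain hs ha hu, pathLoss, if_pos (show q.a ≤ d from hSa hd)]

/-- Constant gain on the disk of radius `a`, a power law up to `r`, and zero gain beyond, where the
integrand vanishes. No tail occurs, so `α > 0` is enough. -/
lemma lintegral_relGain_ball (hα : 0 < q.α) (ha : 0 < q.a) (hs : 0 < β * q.d₀ ^ q.α)
    (hr : q.a ≤ r) (hu : 0 < u) :
    ∫⁻ x : Plane, (1 - expNeg (ENNReal.ofReal u * if ‖x‖ ≤ r then relGain q β ‖x‖ else 0))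
      = ENNReal.ofReal (Real.pi * ibmTerm q β r u) := by
  have hsu : 0 < β * q.d₀ ^ q.α * u := by positivity
  have hF : Measurable fun d : ℝ =>
      1 - expNeg (ENNReal.ofReal u * if d ≤ r then relGain q β d else 0) :=
    measurable_const.sub (measurable_expNeg.comp (measurable_const.mul
      (Measurable.ite measurableSet_Iic (measurable_relGain q β) measurable_const)))
  rw [lintegral_plane_norm hF, lintegral_Ioi_eq_disk_add ha.le
      (c := ENNReal.ofReal (1 - Real.exp (-(β * q.d₀ ^ q.α * u)))) (fun d hd => by
        rw [if_pos (hd.le.trans hr), one_sub_expNeg_relGain hs ha.le hu.le, pathLoss,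
          if_neg (not_le.2 hd), mul_one]),
    ← Ioc_union_Ioi_eq_Ioi hr, lintegral_union measurableSet_Ioi
      (disjoint_left.2 fun d hd hd' => not_lt.2 hd.2 hd')]
  have h1 : ∫⁻ d in Ioc q.a r, ENNReal.ofReal (2 * d)
      * (1 - expNeg (ENNReal.ofReal u * if d ≤ r then relGain q β d else 0))
      = ENNReal.ofReal (ringPrimitive q.α (β * q.d₀ ^ q.α * u) r
        - ringPrimitive q.α (β * q.d₀ ^ q.α * u) q.a) := by
    rw [← lintegral_annulus hα hsu ha hr,
      ← setLIntegral_relGain measurableSet_Ioc (fun d hd => hd.1.le) hs ha.le hu.le]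
    exact setLIntegral_congr_fun measurableSet_Ioc fun d hd => by simp only [if_pos hd.2]
  have h2 : ∫⁻ d in Ioi r, ENNReal.ofReal (2 * d)
      * (1 - expNeg (ENNReal.ofReal u * if d ≤ r then relGain q β d else 0)) = 0 := by
    rw [setLIntegral_congr_fun (g := fun _ => 0) measurableSet_Ioi fun d hd => by
      simp [not_le.2 (show r < d from hd)]]
    simp
  rw [h1, h2, add_zero, ← ENNReal.ofReal_mul (by positivity), ← ENNReal.ofReal_add,
    ← ENNReal.ofReal_mul Real.pi_pos.le, ibmTerm_eq]
  · exact mul_nonneg (by positivity) (one_sub_exp_neg_nonneg hsu.le)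
  · exact sub_nonneg.2 (ringPrimitive_mono hα hsu ha hr)

lemma lintegral_relGain (hα : 2 < q.α) (ha : 0 < q.a) (hs : 0 < β * q.d₀ ^ q.α) (hu : 0 < u) :
    ∫⁻ x : Plane, (1 - expNeg (ENNReal.ofReal u * relGain q β ‖x‖))
      = ENNReal.ofReal (Real.pi * phyTerm q β u) := by
  have hsu : 0 < β * q.d₀ ^ q.α * u := by positivity
  have hF : Measurable fun d : ℝ => 1 - expNeg (ENNReal.ofReal u * relGain q β d) :=
    measurable_const.sub (measurable_expNeg.comp (measurable_const.mul (measurable_relGain q β)))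
  rw [lintegral_plane_norm hF, lintegral_Ioi_eq_disk_add ha.le
      (c := ENNReal.ofReal (1 - Real.exp (-(β * q.d₀ ^ q.α * u)))) (fun d hd => by
        rw [one_sub_expNeg_relGain hs ha.le hu.le, pathLoss, if_neg (not_le.2 hd), mul_one]),
    setLIntegral_relGain measurableSet_Ioi Ioi_subset_Ici_self hs ha.le hu.le,
    lintegral_tail hα hsu ha, ← ENNReal.ofReal_mul (by positivity), ← ENNReal.ofReal_add,
    ← ENNReal.ofReal_mul Real.pi_pos.le, phyTerm_eq]
  · exact mul_nonneg (by positivity) (one_sub_exp_neg_nonneg hsu.le)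
  · exact sub_nonneg.2 (ringPrimitive_le_limit hα hsu ha)

/-- Inside the ball the gain is infinite and the integrand equals `1`, which gives the area term `π
r²`; outside only the tail of the power law remains. -/
lemma lintegral_relGain_forbidden_ball (hα : 2 < q.α) (ha : 0 < q.a)
    (hs : 0 < β * q.d₀ ^ q.α) (hr : q.a ≤ r) (hu : 0 < u) :
    ∫⁻ x : Plane, (1 - expNeg (ENNReal.ofReal u * if ‖x‖ ≤ r then ∞ else relGain q β ‖x‖))
      = ENNReal.ofReal (Real.pi * (r ^ 2 + prmTerm q β r u)) := by
  have hsu : 0 < β * q.d₀ ^ q.α * u := by positivity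
  have hr0 : 0 < r := ha.trans_le hr
  have hF : Measurable fun d : ℝ =>
      1 - expNeg (ENNReal.ofReal u * if d ≤ r then ∞ else relGain q β d) :=
    measurable_const.sub (measurable_expNeg.comp (measurable_const.mul
      (Measurable.ite measurableSet_Iic measurable_const (measurable_relGain q β))))
  have h1 : ∫⁻ d in Ioi r, ENNReal.ofReal (2 * d)
      * (1 - expNeg (ENNReal.ofReal u * if d ≤ r then ∞ else relGain q β d))
      = ENNReal.ofReal (prmTerm q β r u) := by
    rw [prmTerm_eq, ← lintegral_tail hα hsu hr0,
      ← setLIntegral_relGain measurableSet_Ioi (fun d hd => hr.trans (le_of_lt hd)) hs ha.le hu.le]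
    exact setLIntegral_congr_fun measurableSet_Ioi fun d hd => by
      simp only [if_neg (not_le.2 (show r < d from hd))]
  rw [lintegral_plane_norm hF, lintegral_Ioi_eq_disk_add hr0.le (c := 1) (fun d hd => by
      rw [if_pos hd.le, ENNReal.mul_top (by simpa using hu)]; simp), h1, mul_one,
    ← ENNReal.ofReal_add (by positivity), ← ENNReal.ofReal_mul Real.pi_pos.le]
  rw [prmTerm_eq]
  exact sub_nonneg.2 (ringPrimitive_le_limit hα hsu hr0)

/-- Averaging over the mark an identity that holds for every positive value of the mark. -/
lemma integrable_and_lintegral_of_eq_ofReal {g : Plane → ℝ≥0∞} (hg : Measurable g)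
    {F B : ℝ → ℝ}
    (hF : ∀ u, 0 < u → ∫⁻ x, (1 - expNeg (ENNReal.ofReal u * g x))
      = ENNReal.ofReal (Real.pi * F u))
    (hF0 : ∀ u, 0 < u → 0 ≤ F u) (hFB : ∀ u, 0 < u → F u ≤ B u)
    (hB : Integrable B (expMeasure 1)) :
    Integrable F (expMeasure 1) ∧
      ∫⁻ u, ∫⁻ x, (1 - expNeg (ENNReal.ofReal u * g x)) ∂(volume : Measure Plane) ∂(expMeasure 1)
        = ENNReal.ofReal (Real.pi * ∫ u, F u ∂(expMeasure 1)) := by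
  have hm : Measurable fun u : ℝ =>
      ∫⁻ x, (1 - expNeg (ENNReal.ofReal u * g x)) ∂(volume : Measure Plane) := by
    refine Measurable.lintegral_prod_right
      (f := fun (u : ℝ) (x : Plane) => 1 - expNeg (ENNReal.ofReal u * g x)) ?_
    exact measurable_const.sub (measurable_expNeg.comp
      ((ENNReal.measurable_ofReal.comp measurable_fst).mul (hg.comp measurable_snd)))
  -- Measurability of `F` is read off from `hF`: almost everywhere `F` is `π⁻¹` times a parametric
  -- integral.
  have hFm : AEStronglyMeasurable F (expMeasure 1) := by
    refine ((hm.ennreal_toReal.const_mul Real.pi⁻¹).aestronglyMeasurable).congr ?_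
    filter_upwards [ae_pos_expMeasure_one] with u hu
    rw [hF u hu, ENNReal.toReal_ofReal (mul_nonneg Real.pi_pos.le (hF0 u hu)),
      inv_mul_cancel_left₀ Real.pi_pos.ne']
  have hint : Integrable F (expMeasure 1) := by
    refine hB.mono' hFm ?_
    filter_upwards [ae_pos_expMeasure_one] with u hu
    rw [Real.norm_of_nonneg (hF0 u hu)]
    exact hFB u hu
  refine ⟨hint, ?_⟩
  rw [← integral_const_mul, ofReal_integral_eq_lintegral_ofReal (hint.const_mul _)]
  · refine lintegral_congr_ae ?_
    filter_upwards [ae_pos_expMeasure_one] with u hu using hF u hu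
  · filter_upwards [ae_pos_expMeasure_one] with u hu using mul_nonneg Real.pi_pos.le (hF0 u hu)

/-- The factor `1 - exp (-s d^(-α))` is at most `1`. The bound is uniform in `s`, hence a constant
dominates `ibmTerm` for every `α > 0`. -/
lemma ringPrimitive_sub_le {α s a b : ℝ} (hα : 0 < α) (hs : 0 < s) (ha : 0 < a) (hab : a ≤ b) :
    ringPrimitive α s b - ringPrimitive α s a ≤ b ^ 2 := by
  rw [← ENNReal.ofReal_le_ofReal_iff (by positivity), ← lintegral_annulus hα hs ha hab,
    ← lintegral_Ioc_two_mul (ha.le.trans hab)]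
  refine (lintegral_mono fun d => ?_).trans
    (lintegral_mono_set (Ioc_subset_Ioc_left ha.le) : _ ≤ _)
  refine mul_le_of_le_one_right' ?_
  rw [ENNReal.ofReal_le_one]
  linarith [Real.exp_pos (-(s * d ^ (-α)))]

lemma integrable_ibmTerm (hα : 0 < q.α) (ha : 0 < q.a) (hs : 0 < β * q.d₀ ^ q.α)
    (hr : q.a ≤ r) :
    Integrable (ibmTerm q β r) (expMeasure 1) ∧
      ∫⁻ u, ∫⁻ x : Plane, (1 - expNeg (ENNReal.ofReal u *
          if ‖x‖ ≤ r then relGain q β ‖x‖ else 0)) ∂(volume : Measure Plane) ∂(expMeasure 1)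
        = ENNReal.ofReal (Real.pi * ∫ u, ibmTerm q β r u ∂(expMeasure 1)) ∧
      0 ≤ ∫ u, ibmTerm q β r u ∂(expMeasure 1) := by
  have hnonneg : ∀ u, 0 < u → 0 ≤ ibmTerm q β r u := fun u hu => by
    have hsu : 0 < β * q.d₀ ^ q.α * u := by positivity
    rw [ibmTerm_eq]
    exact add_nonneg (mul_nonneg (by positivity) (one_sub_exp_neg_nonneg hsu.le))
      (sub_nonneg.2 (ringPrimitive_mono hα hsu ha hr))
  have hg : Measurable fun x : Plane => if ‖x‖ ≤ r then relGain q β ‖x‖ else 0 :=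
    Measurable.ite (measurableSet_le measurable_norm measurable_const)
      ((measurable_relGain q β).comp measurable_norm) measurable_const
  have h := integrable_and_lintegral_of_eq_ofReal (B := fun _ => q.a ^ 2 + r ^ 2) hg
    (fun u hu => lintegral_relGain_ball hα ha hs hr hu) hnonneg (fun u hu => ?_)
    (integrable_const _)
  · exact ⟨h.1, h.2, integral_nonneg_of_ae
      (by filter_upwards [ae_pos_expMeasure_one] with u hu using hnonneg u hu)⟩
  · rw [ibmTerm_eq]
    refine add_le_add (mul_le_of_le_one_right (by positivity) ?_)
      (ringPrimitive_sub_le hα (by positivity) ha hr)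
    linarith [Real.exp_pos (-(β * q.d₀ ^ q.α * u))]

/-- Strictness comes from the disk of radius `a`; it makes the physical outage probability positive
even without noise. -/
lemma phyTerm_pos (hα : 2 < q.α) (ha : 0 < q.a) (hs : 0 < β * q.d₀ ^ q.α) (hu : 0 < u) :
    0 < phyTerm q β u := by
  have hsu : 0 < β * q.d₀ ^ q.α * u := by positivity
  rw [phyTerm_eq]
  refine add_pos_of_pos_of_nonneg (mul_pos (by positivity) ?_)
    (sub_nonneg.2 (ringPrimitive_le_limit hα hsu ha))
  simpa using hsu

lemma integrable_const_add_mul_rpow_expMeasure_one (b c : ℝ) {s : ℝ} (hs : 0 ≤ s) :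
    Integrable (fun u : ℝ => b + c * u ^ s) (expMeasure 1) :=
  (integrable_const b).add ((integrable_rpow_expMeasure_one hs).const_mul c)

lemma integrable_phyTerm (hα : 2 < q.α) (ha : 0 < q.a) (hs : 0 < β * q.d₀ ^ q.α) :
    Integrable (phyTerm q β) (expMeasure 1) ∧
      ∫⁻ u, ∫⁻ x : Plane, (1 - expNeg (ENNReal.ofReal u * relGain q β ‖x‖))
          ∂(volume : Measure Plane) ∂(expMeasure 1)
        = ENNReal.ofReal (Real.pi * ∫ u, phyTerm q β u ∂(expMeasure 1)) ∧
      0 < ∫ u, phyTerm q β u ∂(expMeasure 1) := by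
  have hα0 : 0 ≤ 2 / q.α := div_nonneg zero_le_two (by linarith)
  have hbound : ∀ u, 0 < u → phyTerm q β u
      ≤ q.a ^ 2 + (β * q.d₀ ^ q.α) ^ (2 / q.α) * Real.Gamma (1 - 2 / q.α) * u ^ (2 / q.α) := by
    intro u hu
    have hsu : 0 < β * q.d₀ ^ q.α * u := mul_pos hs hu
    rw [phyTerm_eq]
    refine add_le_add (mul_le_of_le_one_right (sq_nonneg _) ?_) ?_
    · linarith [Real.exp_pos (-(β * q.d₀ ^ q.α * u))]
    · rw [Real.mul_rpow hs.le hu.le]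
      linarith [ringPrimitive_nonneg (α := q.α) hsu.le ha.le]
  have hg : Measurable fun x : Plane => relGain q β ‖x‖ :=
    (measurable_relGain q β).comp measurable_norm
  have h := integrable_and_lintegral_of_eq_ofReal hg
    (fun u hu => lintegral_relGain hα ha hs hu) (fun u hu => (phyTerm_pos hα ha hs hu).le)
    hbound (integrable_const_add_mul_rpow_expMeasure_one _ _ hα0)
  refine ⟨h.1, h.2, ?_⟩
  rw [integral_pos_iff_support_of_nonneg_ae
    (by filter_upwards [ae_pos_expMeasure_one] with u hu using (phyTerm_pos hα ha hs hu).le) h.1]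
  have hone : expMeasure 1 (Ioi 0) = 1 :=
    (mem_ae_iff_prob_eq_one measurableSet_Ioi).1 ae_pos_expMeasure_one
  refine lt_of_lt_of_le ?_ (measure_mono fun u hu => (phyTerm_pos hα ha hs hu).ne' :
    expMeasure 1 (Ioi 0) ≤ _)
  rw [hone]
  exact one_pos

lemma integrable_prmTerm (hα : 2 < q.α) (ha : 0 < q.a) (hs : 0 < β * q.d₀ ^ q.α)
    (hr : q.a ≤ r) :
    Integrable (prmTerm q β r) (expMeasure 1) ∧
      ∫⁻ u, ∫⁻ x : Plane, (1 - expNeg (ENNReal.ofReal u *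
          if ‖x‖ ≤ r then ∞ else relGain q β ‖x‖)) ∂(volume : Measure Plane) ∂(expMeasure 1)
        = ENNReal.ofReal (Real.pi * (r ^ 2 + ∫ u, prmTerm q β r u ∂(expMeasure 1))) ∧
      0 ≤ ∫ u, prmTerm q β r u ∂(expMeasure 1) := by
  have hα0 : 0 ≤ 2 / q.α := div_nonneg zero_le_two (by linarith)
  have hr0 : 0 < r := ha.trans_le hr
  have hnonneg : ∀ u, 0 < u → 0 ≤ prmTerm q β r u := fun u hu => by
    rw [prmTerm_eq]
    exact sub_nonneg.2 (ringPrimitive_le_limit hα (mul_pos hs hu) hr0)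
  have hbound : ∀ u, 0 < u → r ^ 2 + prmTerm q β r u
      ≤ r ^ 2 + (β * q.d₀ ^ q.α) ^ (2 / q.α) * Real.Gamma (1 - 2 / q.α) * u ^ (2 / q.α) := by
    intro u hu
    have hsu : 0 < β * q.d₀ ^ q.α * u := mul_pos hs hu
    rw [prmTerm_eq, Real.mul_rpow hs.le hu.le]
    linarith [ringPrimitive_nonneg (α := q.α) hsu.le hr0.le]
  have hg : Measurable fun x : Plane => if ‖x‖ ≤ r then ∞ else relGain q β ‖x‖ :=
    Measurable.ite (measurableSet_le measurable_norm measurable_const) measurable_const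
      ((measurable_relGain q β).comp measurable_norm)
  have h := integrable_and_lintegral_of_eq_ofReal hg
    (fun u hu => lintegral_relGain_forbidden_ball hα ha hs hr hu)
    (fun u hu => add_nonneg (sq_nonneg r) (hnonneg u hu)) hbound
    (integrable_const_add_mul_rpow_expMeasure_one _ _ hα0)
  -- The averaging lemma is applied to `r² + prmTerm`; the constant is removed afterwards.
  have hint : Integrable (prmTerm q β r) (expMeasure 1) :=
    (integrable_add_iff_integrable_right' (integrable_const (r ^ 2))).1 h.1
  refine ⟨hint, ?_, integral_nonneg_of_ae
    (by filter_upwards [ae_pos_expMeasure_one] with u hu using hnonneg u hu)⟩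
  rw [h.2, integral_add (integrable_const _) hint]
  simp

end Terms

/-! ### Outage events -/

lemma compl_noOutage {Ω : Type*} (γ : Ω → ℝ≥0∞) (β : ℝ) : (noOutage γ β)ᶜ = outage γ β := by
  ext ω
  simp [noOutage, outage]

/-- The SINR exceeds the threshold iff the fading of the intended link exceeds the sum of the
normalized noise and interference. -/
lemma le_sinr_iff {q : Params} (hp : 0 < q.p) (hc : 0 < q.c) (ha : 0 < q.a) (hd₀ : q.a ≤ q.d₀)
    {β : ℝ} (hβ : 0 < β) (noise : ℝ) (w : ℕ → ℝ≥0∞) (x : ℕ → Plane) {h₀ : ℝ} (hh₀ : 0 < h₀)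
    (h : ℕ → ℝ) :
    ENNReal.ofReal β ≤ sinr q noise w x h₀ h ↔
      ENNReal.ofReal (noise * β * q.d₀ ^ q.α / (q.p * q.c))
        + ∑' k, ENNReal.ofReal (h k) * (w k * relGain q β ‖x k‖) ≤ ENNReal.ofReal h₀ := by
  have hd : 0 < q.d₀ := ha.trans_le hd₀
  have hm : 0 < q.d₀ ^ q.α / (q.p * q.c) := by positivity
  have hN : 0 < q.p * channelGain q h₀ q.d₀ := by
    rw [channelGain, pathLoss, if_pos hd₀]
    positivity
  -- The factor `d₀^α / (p c)` normalizes the received power of the intended link to `h₀`.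
  have hN' : ENNReal.ofReal (q.d₀ ^ q.α / (q.p * q.c))
      * ENNReal.ofReal (q.p * channelGain q h₀ q.d₀) = ENNReal.ofReal h₀ := by
    rw [← ENNReal.ofReal_mul hm.le, channelGain, pathLoss, if_pos hd₀, Real.rpow_neg hd.le]
    congr 1
    field_simp
  have hterm : ∀ k, ENNReal.ofReal (q.d₀ ^ q.α / (q.p * q.c)) * (ENNReal.ofReal β *
      (ENNReal.ofReal q.p * (w k * ENNReal.ofReal (channelGain q (h k) ‖x k‖))))
      = ENNReal.ofReal (h k) * (w k * relGain q β ‖x k‖) := fun k => by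
    have hl := pathLoss_nonneg (α := q.α) (d := ‖x k‖) ha.le
    have hconst : ENNReal.ofReal (q.d₀ ^ q.α / (q.p * q.c)) * ENNReal.ofReal β
        * ENNReal.ofReal q.p * ENNReal.ofReal q.c = ENNReal.ofReal (β * q.d₀ ^ q.α) := by
      rw [← ENNReal.ofReal_mul hm.le, ← ENNReal.ofReal_mul (by positivity),
        ← ENNReal.ofReal_mul (by positivity)]
      congr 1
      field_simp
    rw [relGain, channelGain, ENNReal.ofReal_mul (p := β * q.d₀ ^ q.α) (by positivity), ← hconst,
      ENNReal.ofReal_mul' hl, ENNReal.ofReal_mul hc.le]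
    ring
  have hnoise : ENNReal.ofReal (q.d₀ ^ q.α / (q.p * q.c)) * (ENNReal.ofReal β *
      ENNReal.ofReal noise) = ENNReal.ofReal (noise * β * q.d₀ ^ q.α / (q.p * q.c)) := by
    rw [← ENNReal.ofReal_mul hβ.le, ← ENNReal.ofReal_mul hm.le]
    congr 1
    field_simp
  -- The denominator may be `0` or `∞`; clearing it is legitimate because the numerator is positive
  -- (from `h₀ > 0`) and finite.
  rw [sinr, ENNReal.le_div_iff_mul_le (.inr (by simpa using hN)) (.inr ENNReal.ofReal_ne_top),
    ← ENNReal.mul_le_mul_iff_right (a := ENNReal.ofReal (q.d₀ ^ q.α / (q.p * q.c)))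
      (by simpa using hm) ENNReal.ofReal_ne_top, hN', mul_add, mul_add, hnoise,
    ← ENNReal.tsum_mul_left, ← ENNReal.tsum_mul_left, add_comm]
  simp_rw [hterm]

lemma measureReal_cond {Ω : Type*} [MeasurableSpace Ω] {P : Measure Ω} {s : Set Ω}
    (hs : MeasurableSet s) (t : Set Ω) :
    (cond P s).real t = (P.real s)⁻¹ * P.real (s ∩ t) := by
  simp [measureReal_def, cond_apply hs, ENNReal.toReal_mul, ENNReal.toReal_inv]

/-! ### Measurability and probabilities of the coverage events -/

section Network

variable {Ω : Type*} [MeasurableSpace Ω] {P : Measure Ω} {q : Params} {lam β : ℝ}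
  {X : ℕ → Ω → Plane} {h₀ : Ω → ℝ} {h : ℕ → Ω → ℝ}

lemma IsRayleighPoissonNetwork.measurable_sinr (hnet : IsRayleighPoissonNetwork P lam X h₀ h)
    (q : Params) (noise : ℝ) {w : Plane → ℝ≥0∞} (hw : Measurable w) :
    Measurable fun ω =>
      sinr q noise (fun k => w (X k ω)) (fun k => X k ω) (h₀ ω) (fun k => h k ω) := by
  have h0 := hnet.measurable_h₀
  have hX := hnet.poisson.measurable
  have hh := hnet.measurable_h
  unfold sinr channelGain
  refine Measurable.div (by fun_prop) (Measurable.add (Measurable.tsum fun k => ?_)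
    measurable_const)
  exact measurable_const.mul ((hw.comp (hX k)).mul (ENNReal.measurable_ofReal.comp
    (((hh k).const_mul _).mul ((measurable_pathLoss _ _).comp (hX k).norm))))

lemma IsRayleighPoissonNetwork.ae_pos_h₀ (hnet : IsRayleighPoissonNetwork P lam X h₀ h) :
    ∀ᵐ ω ∂P, 0 < h₀ ω :=
  ae_of_ae_map hnet.measurable_h₀.aemeasurable (hnet.law_h₀ ▸ ae_pos_expMeasure_one)

lemma IsRayleighPoissonNetwork.ae_pos_h (hnet : IsRayleighPoissonNetwork P lam X h₀ h) :
    ∀ᵐ ω ∂P, ∀ k, 0 < h k ω :=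
  ae_all_iff.2 fun k =>
    ae_of_ae_map (hnet.measurable_h k).aemeasurable (hnet.law_h k ▸ ae_pos_expMeasure_one)

/-- Probability of an event that coincides almost surely with coverage for the gains `g`. -/
lemma IsRayleighPoissonNetwork.measureReal_of_ae_iff [IsProbabilityMeasure P]
    (hnet : IsRayleighPoissonNetwork P lam X h₀ h) (hlam : 0 ≤ lam) {g : Plane → ℝ≥0∞}
    (hg : Measurable g) {t J : ℝ} (ht : 0 ≤ t) (hJ : 0 ≤ J)
    (hgJ : ∫⁻ u, ∫⁻ x, (1 - expNeg (ENNReal.ofReal u * g x)) ∂(volume : Measure Plane)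
      ∂(expMeasure 1) = ENNReal.ofReal (Real.pi * J))
    {A : Set Ω} (hA : ∀ᵐ ω ∂P, ω ∈ A ↔
      ENNReal.ofReal t + ∑' k, ENNReal.ofReal (h k ω) * g (X k ω) ≤ ENNReal.ofReal (h₀ ω)) :
    P.real A = Real.exp (-t - Real.pi * lam * J) := by
  have hJ' : 0 ≤ Real.pi * J := mul_nonneg Real.pi_pos.le hJ
  have hAe : A =ᵐ[P] {ω | ENNReal.ofReal t + ∑' k, ENNReal.ofReal (h k ω) * g (X k ω)
      ≤ ENNReal.ofReal (h₀ ω)} := eventuallyEq_set.2 hA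
  rw [measureReal_def, measure_congr hAe, hnet.coverage hg, hgJ, ← ENNReal.ofReal_mul hlam,
    ← ENNReal.ofReal_add ht (mul_nonneg hlam hJ'),
    expNeg_ofReal (add_nonneg ht (mul_nonneg hlam hJ')), ENNReal.toReal_ofReal (Real.exp_pos _).le]
  ring_nf

/-- An interferer in range contributes `∞` times a positive gain; with none in range and no noise,
the denominator is `0`. Positivity of the fading is what restricts this to almost every outcome. -/
lemma IsRayleighPoissonNetwork.ae_sinrPRM_lt_iff (hnet : IsRayleighPoissonNetwork P lam X h₀ h)
    (hp : 0 < q.p) (hc : 0 < q.c) (ha : 0 < q.a) (hd₀ : q.a ≤ q.d₀) (hβ : 0 < β) (r : ℝ) :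
    ∀ᵐ ω ∂P, sinrPRM q r X h₀ h ω < ENNReal.ofReal β ↔ ∃ k, ‖X k ω‖ ≤ r := by
  filter_upwards [hnet.ae_pos_h₀, hnet.ae_pos_h] with ω h0 hk
  have hd : 0 < q.d₀ := ha.trans_le hd₀
  rw [← not_le, sinrPRM, le_sinr_iff hp hc ha hd₀ hβ 0 _ _ h0, not_iff_comm]
  constructor
  · intro hno
    simp only [not_exists] at hno
    simp [hno]
  · rintro hle ⟨k, hkr⟩
    have hgain : 0 < β * q.d₀ ^ q.α * pathLoss q.α q.a ‖X k ω‖ := by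
      refine mul_pos (by positivity) ?_
      unfold pathLoss
      split_ifs with hak
      · exact Real.rpow_pos_of_pos (ha.trans_le hak) _
      · exact one_pos
    have htop : ∞ ≤ ∑' k, ENNReal.ofReal (h k ω)
        * ((if ‖X k ω‖ ≤ r then ∞ else 0) * relGain q β ‖X k ω‖) := by
      refine le_trans (le_of_eq ?_) (ENNReal.le_tsum k)
      rw [if_pos hkr, ENNReal.top_mul (by simpa [relGain] using hgain),
        ENNReal.mul_top (by simpa using hk k)]
    exact absurd ((htop.trans le_add_self).trans hle) (by simp)

lemma IsRayleighPoissonNetwork.measureReal_forall_lt_norm [IsProbabilityMeasure P]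
    (hnet : IsRayleighPoissonNetwork P lam X h₀ h) (hlam : 0 ≤ lam) {r : ℝ} (hr : 0 ≤ r) :
    P.real {ω | ∀ k, r < ‖X k ω‖} = Real.exp (-(lam * Real.pi * r ^ 2)) := by
  have hvol : (ENNReal.ofReal lam • (volume : Measure Plane)) (Metric.closedBall 0 r)
      = ENNReal.ofReal (lam * Real.pi * r ^ 2) := by
    rw [Measure.smul_apply, EuclideanSpace.volume_closedBall_fin_two, smul_eq_mul,
      ← ENNReal.ofReal_pow hr, ← ENNReal.ofReal_mul (by positivity), ← ENNReal.ofReal_mul hlam]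
    ring_nf
  have h := hnet.poisson.count_law (Metric.closedBall 0 r) measurableSet_closedBall
    (by rw [hvol]; exact ENNReal.ofReal_ne_top) 0
  have hset : {ω | pointCount (fun k => X k ω) (Metric.closedBall 0 r) = ((0 : ℕ) : ℕ∞)}
      = {ω | ∀ k, r < ‖X k ω‖} := by
    ext ω
    simp [pointCount, Set.eq_empty_iff_forall_notMem]
  have hpos : 0 ≤ lam * Real.pi * r ^ 2 := by positivity
  rw [hset, hvol, poissonMeasure_singleton] at h
  rw [measureReal_def, h, ENNReal.toReal_ofReal (by positivity)]
  rw [show ((ENNReal.ofReal (lam * Real.pi * r ^ 2)).toNNReal : ℝ) = lam * Real.pi * r ^ 2 from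
    ENNReal.toReal_ofReal hpos]
  simp

end Network

end OutageModel

/-! ### Event probabilities and accuracy indices -/

open OutageModel in
theorem mainTheorem3 {Ω : Type*} [MeasurableSpace Ω] (P : Measure Ω) [IsProbabilityMeasure P]
    (q : Params) (hp : 0 < q.p) (hc : 0 < q.c) (hα : 0 < q.α) (ha : 0 < q.a) (hσ : 0 ≤ q.σ)
    (hd₀ : q.a ≤ q.d₀)
    (lam : ℝ) (hlam : 0 < lam) (β : ℝ) (hβ : 0 < β)
    (rIBM : ℝ) (hrIBM : q.a ≤ rIBM) (rPRM : ℝ) (hrPRM : q.a ≤ rPRM)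
    (X : ℕ → Ω → Plane) (h₀ : Ω → ℝ) (h : ℕ → Ω → ℝ)
    (hnet : IsRayleighPoissonNetwork P lam X h₀ h)
    (γPhyM γIBM γPRM : Ω → ℝ≥0∞)
    (hPhyM : γPhyM = sinrPhyM q X h₀ h)
    (hIBM : γIBM = sinrIBM q rIBM X h₀ h)
    (hPRM : γPRM = sinrPRM q rPRM X h₀ h) :
    -- interference ball model
    (Integrable (ibmTerm q β rIBM) (expMeasure 1) ∧
      P.real (outage γIBM β) = ibmOutage q lam β rIBM) ∧
    -- protocol model
    ((∀ᵐ ω ∂P, γPRM ω < ENNReal.ofReal β ↔ ∃ k, ‖X k ω‖ ≤ rPRM) ∧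
      P.real (outage γPRM β) = prmOutage lam rPRM) ∧
    (2 < q.α →
      -- physical model
      (Integrable (phyTerm q β) (expMeasure 1) ∧
        P.real (outage γPhyM β) = phyOutage q lam β ∧
        0 < phyOutage q lam β ∧ phyOutage q lam β < 1) ∧
      -- physical model given no outage under the protocol model
      (Integrable (prmTerm q β rPRM) (expMeasure 1) ∧
        (cond P (noOutage γPRM β)).real (outage γPhyM β) = phyOutageGivenPRM q lam β rPRM) ∧
      -- accuracy index of the interference ball model
      (falseAlarm P β γIBM γPhyM = 0 ∧
        missDetection P β γIBM γPhyM = 1 - ibmOutage q lam β rIBM / phyOutage q lam β ∧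
        (∀ ξ ∈ Icc (0 : ℝ) 1, similarityIndex P β ξ γIBM γPhyM
          = 1 - (1 - ξ) * (1 - ibmOutage q lam β rIBM / phyOutage q lam β)) ∧
        similarityIndex P β (P.real (noOutage γPhyM β)) γIBM γPhyM
          = 1 - (phyOutage q lam β - ibmOutage q lam β rIBM)) ∧
      -- accuracy index of the protocol model
      (falseAlarm P β γPRM γPhyM
          = 1 - (1 - prmOutage lam rPRM) * (1 - phyOutageGivenPRM q lam β rPRM)
              / (1 - phyOutage q lam β) ∧
        missDetection P β γPRM γPhyM
          = (1 - prmOutage lam rPRM) * phyOutageGivenPRM q lam β rPRM / phyOutage q lam β ∧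
        (∀ ξ ∈ Icc (0 : ℝ) 1, similarityIndex P β ξ γPRM γPhyM
          = 1 - ξ * (1 - (1 - prmOutage lam rPRM) * (1 - phyOutageGivenPRM q lam β rPRM)
                / (1 - phyOutage q lam β))
              - (1 - ξ) * ((1 - prmOutage lam rPRM) * phyOutageGivenPRM q lam β rPRM
                / phyOutage q lam β)) ∧
        similarityIndex P β (P.real (noOutage γPhyM β)) γPRM γPhyM
          = phyOutage q lam β
              + (1 - prmOutage lam rPRM) * (1 - 2 * phyOutageGivenPRM q lam β rPRM))) := by
  subst hPhyM hIBM hPRM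
  have hd : 0 < q.d₀ := ha.trans_le hd₀
  have hs : 0 < β * q.d₀ ^ q.α := by positivity
  have hrP : 0 < rPRM := ha.trans_le hrPRM
  have ht : 0 ≤ q.σ * β * q.d₀ ^ q.α / (q.p * q.c) := by positivity
  have hball : ∀ r : ℝ, MeasurableSet {x : Plane | ‖x‖ ≤ r} := fun r =>
    measurableSet_le measurable_norm measurable_const
  have hgain : Measurable fun x : Plane => relGain q β ‖x‖ :=
    (measurable_relGain q β).comp measurable_norm
  set A := noOutage (sinrPhyM q X h₀ h) β with hAdef
  set I := noOutage (sinrIBM q rIBM X h₀ h) β with hIdef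
  set R := noOutage (sinrPRM q rPRM X h₀ h) β with hRdef
  have hAm : MeasurableSet A := measurableSet_le measurable_const
    (hnet.measurable_sinr q q.σ (w := fun _ => 1) measurable_const)
  have hIm : MeasurableSet I := measurableSet_le measurable_const
    (hnet.measurable_sinr q q.σ (w := fun x => if ‖x‖ ≤ rIBM then 1 else 0)
      (Measurable.ite (hball _) measurable_const measurable_const))
  have hRm : MeasurableSet R := measurableSet_le measurable_const
    (hnet.measurable_sinr q 0 (w := fun x => if ‖x‖ ≤ rPRM then ∞ else 0)
      (Measurable.ite (hball _) measurable_const measurable_const))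
  have hPRMae := hnet.ae_sinrPRM_lt_iff hp hc ha hd₀ hβ rPRM
  have hRae : ∀ᵐ ω ∂P, ω ∈ R ↔ ∀ k, rPRM < ‖X k ω‖ := by
    filter_upwards [hPRMae] with ω hω
    rw [← not_iff_not]
    simpa [hRdef, noOutage] using hω
  have hAiff : ∀ᵐ ω ∂P, ω ∈ A ↔ ENNReal.ofReal (q.σ * β * q.d₀ ^ q.α / (q.p * q.c))
      + ∑' k, ENNReal.ofReal (h k ω) * relGain q β ‖X k ω‖ ≤ ENNReal.ofReal (h₀ ω) := by
    filter_upwards [hnet.ae_pos_h₀] with ω h0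
    have hiff := le_sinr_iff hp hc ha hd₀ hβ q.σ (fun _ => 1) (fun k => X k ω) h0
      (fun k => h k ω)
    simp only [one_mul] at hiff
    exact hiff
  obtain ⟨hIint, hIlint, hIpos⟩ := integrable_ibmTerm (β := β) hα ha hs hrIBM
  have hPI : P.real I = 1 - ibmOutage q lam β rIBM := by
    rw [ibmOutage, closedForm, sub_sub_cancel, neg_div]
    refine hnet.measureReal_of_ae_iff hlam.le
      (Measurable.ite (hball rIBM) hgain measurable_const) ht hIpos hIlint ?_
    filter_upwards [hnet.ae_pos_h₀] with ω h0
    have hiff := le_sinr_iff hp hc ha hd₀ hβ q.σ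
      (fun k => if ‖X k ω‖ ≤ rIBM then 1 else 0) (fun k => X k ω) h0 (fun k => h k ω)
    simp only [ite_mul, one_mul, zero_mul] at hiff
    exact hiff
  have hPR : P.real R = 1 - prmOutage lam rPRM := by
    rw [prmOutage, sub_sub_cancel, ← hnet.measureReal_forall_lt_norm hlam.le hrP.le]
    exact measureReal_congr (Filter.eventuallyEq_set.2 hRae)
  simp only [falseAlarm, missDetection, similarityIndex, ← compl_noOutage, ← hAdef, ← hIdef,
    ← hRdef]
  refine ⟨⟨hIint, ?_⟩, ⟨hPRMae, ?_⟩, fun hα2 => ?_⟩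
  · rw [probReal_compl_eq_one_sub hIm, hPI, sub_sub_cancel]
  · rw [probReal_compl_eq_one_sub hRm, hPR, sub_sub_cancel]
  obtain ⟨hAint, hAlint, hApos⟩ := integrable_phyTerm (β := β) hα2 ha hs
  obtain ⟨hQint, hQlint, hQpos⟩ := integrable_prmTerm (β := β) hα2 ha hs hrPRM
  have hPA : P.real A = 1 - phyOutage q lam β := by
    rw [phyOutage, closedForm, sub_sub_cancel, neg_div]
    exact hnet.measureReal_of_ae_iff hlam.le hgain ht hApos.le hAlint hAiff
  -- Joint coverage is coverage for the gain set to `∞` on the ball, so no conditional point process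
  -- is needed; the `r²` part of the exponent is the factor `P(R)`.
  have hPRA : P.real (R ∩ A)
      = (1 - prmOutage lam rPRM) * (1 - phyOutageGivenPRM q lam β rPRM) := by
    rw [phyOutageGivenPRM, prmOutage, closedForm, sub_sub_cancel, sub_sub_cancel, neg_div,
      ← Real.exp_add, hnet.measureReal_of_ae_iff hlam.le
        (Measurable.ite (hball rPRM) measurable_const hgain) ht
        (add_nonneg (sq_nonneg rPRM) hQpos) hQlint (A := R ∩ A)]
    · ring_nf
    filter_upwards [hAiff, hRae, hnet.ae_pos_h] with ω hA hR hk
    rw [mem_inter_iff, hA, hR]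
    by_cases hfar : ∀ k, rPRM < ‖X k ω‖
    · simp [hfar, fun k => not_le.2 (hfar k)]
    · simp only [hfar, false_and, false_iff, not_le]
      obtain ⟨k, hkr⟩ := not_forall.1 hfar
      have htop : ∞ ≤ ∑' k, ENNReal.ofReal (h k ω)
          * (if ‖X k ω‖ ≤ rPRM then ∞ else relGain q β ‖X k ω‖) := by
        refine le_trans (le_of_eq ?_) (ENNReal.le_tsum k)
        rw [if_pos (not_lt.1 hkr), ENNReal.mul_top (by simpa using hk k)]
      exact ENNReal.ofReal_lt_top.trans_le (htop.trans le_add_self)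
  have hPRpos : 0 < 1 - prmOutage lam rPRM := by
    rw [prmOutage, sub_sub_cancel]
    exact Real.exp_pos _
  have hphy1 : phyOutage q lam β < 1 := by
    rw [phyOutage, closedForm]
    linarith [Real.exp_pos (-(q.σ * β * q.d₀ ^ q.α) / (q.p * q.c)
      - Real.pi * lam * ∫ x, phyTerm q β x ∂(expMeasure 1))]
  have hphy0 : 0 < phyOutage q lam β := by
    rw [phyOutage, closedForm, sub_pos, Real.exp_lt_one_iff, neg_div]
    have : 0 < Real.pi * lam * ∫ x, phyTerm q β x ∂(expMeasure 1) :=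
      mul_pos (mul_pos Real.pi_pos hlam) hApos
    linarith
  -- Dropping interferers can only raise the SINR, pointwise; hence no false alarms, and the missed
  -- outages form `I \ A`.
  have hAI : A ⊆ I := fun ω hω => by
    refine le_trans (show ENNReal.ofReal β ≤ sinrPhyM q X h₀ h ω from hω) ?_
    unfold sinrPhyM sinrIBM sinr
    refine ENNReal.div_le_div_left (add_le_add_left (ENNReal.tsum_le_tsum fun k => ?_) _) _
    gcongr
    dsimp only
    split_ifs <;> simp
  have hPAc : P.real Aᶜ = phyOutage q lam β := by
    rw [probReal_compl_eq_one_sub hAm, hPA, sub_sub_cancel]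
  have hfaI : (cond P A).real Iᶜ = 0 := by
    have hempty : A ∩ Iᶜ = ∅ := by
      rw [← Set.sdiff_eq]
      exact sdiff_eq_empty.2 hAI
    rw [measureReal_cond hAm, hempty]
    simp
  have hmdI : (cond P Aᶜ).real I = 1 - ibmOutage q lam β rIBM / phyOutage q lam β := by
    have hinter : P.real (Aᶜ ∩ I) = P.real I - P.real A := by
      rw [inter_comm, ← Set.sdiff_eq, measureReal_sdiff hAI hAm]
    rw [measureReal_cond hAm.compl, hinter, hPAc, hPI, hPA]
    field_simp
    ring
  have hfaR : (cond P A).real Rᶜ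
      = 1 - (1 - prmOutage lam rPRM) * (1 - phyOutageGivenPRM q lam β rPRM)
          / (1 - phyOutage q lam β) := by
    -- Both protocol-model errors reduce to `P(R ∩ A)`: false alarms are `A` minus it, missed
    -- outages `R` minus it.
    have hinter : P.real (A ∩ Rᶜ) = P.real A - P.real (R ∩ A) := by
      rw [← Set.sdiff_eq, inter_comm R A, ← measureReal_inter_add_sdiff (s := A) hRm]
      ring
    rw [measureReal_cond hAm, hinter, hPA, hPRA]
    have : 1 - phyOutage q lam β ≠ 0 := by linarith
    field_simp
  have hRAc : P.real (R ∩ Aᶜ)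
      = (1 - prmOutage lam rPRM) * phyOutageGivenPRM q lam β rPRM := by
    have := measureReal_inter_add_sdiff (μ := P) (s := R) hAm
    rw [Set.sdiff_eq, hPRA, hPR] at this
    linarith
  have hmdR : (cond P Aᶜ).real R
      = (1 - prmOutage lam rPRM) * phyOutageGivenPRM q lam β rPRM / phyOutage q lam β := by
    rw [measureReal_cond hAm.compl, inter_comm, hRAc, hPAc]
    field_simp
  have hcond : (cond P R).real Aᶜ = phyOutageGivenPRM q lam β rPRM := by
    rw [measureReal_cond hRm, hRAc, hPR]
    field_simp
  have hphy1' : 1 - phyOutage q lam β ≠ 0 := by linarith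
  refine ⟨⟨hAint, hPAc, hphy0, hphy1⟩, ⟨hQint, hcond⟩, ⟨hfaI, hmdI, fun ξ _ => ?_, ?_⟩,
    ⟨hfaR, hmdR, fun ξ _ => ?_, ?_⟩⟩
  · rw [hfaI, hmdI]
    ring
  · rw [hfaI, hmdI, hPA]
    field_simp
    ring
  · rw [hfaR, hmdR]
    ring
  · rw [hfaR, hmdR, hPA]
    field_simp
    ring
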